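/- **Setting.** For a sequence $e=(e_n)_{n\ge0}$ let $N(t)=\#\{n\ge 0: e_0+\dots+e_n\le t\}$. For positive sequences $\vec\lambda=(\lambda_n)_{n\ge0}$ with $\sum_n\lambda_n^{-1}=\infty$ and $\vec\mu=(\mu_n)_{n\ge0}$, the Poisson-modulated exponential distribution $\mathrm{PoExp}(\vec\lambda,\vec\mu)$ is the distribution on $[0,\infty]$ with survivor function $$\overline F_{\vec\lambda,\vec\mu}(t)=\mathbb E\exp\Big(-\int_0^t\mu_{N(s)}\,\mathrm ds\Big),\qquad t\ge0,$$ where $N$ is built from independent $e_n\sim\mathrm{Exp}(\lambda_n)$. Let $(\Omega,\mathcal F,\mathbb P)$ be a probability space, and for $i\in\{0,1\}$, $n\ge0$ let $\lambda^{(i)}_n,\mu^{(i)}_n>0$ with $\sum_n1/\lambda^{(i)}_n=\infty$, and $c^{(i)}(n)\in\mathbb R$. Fix the initial pattern $\varepsilon_0\in\{0,1\}$ and let $\varepsilon_m$ alternate, $\varepsilon_{m+1}=1-\varepsilon_m$. For each $m\ge0$ let $\tau_{m,n}\sim\mathrm{Exp}(\lambda_n^{(\varepsilon_m)})$, $n\ge0$,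 be independent, let $N_m$ be the counting process of the shocks $\tau_{m,0}+\dots+\tau_{m,n}$, and let $T_{m+1}\in[0,\infty]$ satisfy $$\mathbb P\big(T_{m+1}>t\mid (\tau_{m,n})_n\big)=\exp\Big(-\int_0^t\mu^{(\varepsilon_m)}_{N_m(s)}\,\mathrm ds\Big),\qquad t\ge0;$$ the pairs $((\tau_{m,n})_n,T_{m+1})$, $m\ge0$, are independent. Let $r_m(n),R_m(n)$ be random variables that are jointly independent of all $\tau_{m,n},T_m$. Put $T^{(+,m)}=T_1+\dots+T_m$, $M(t)=\#\{m\ge1:T^{(+,m)}\le t\}$, $\varepsilon(t)=\varepsilon_{M(t)}$. For $a^{(i)}(n)\in\mathbb R$ let $$\mathbb L_a(t)=\sum_{m=1}^{M(t)}\int_0^{T_m}a^{(\varepsilon_{m-1})}(N_{m-1}(s))\,\mathrm ds+\int_0^{t-T^{(+,M(t))}}a^{(\varepsilon_{M(t)})}(N_{M(t)}(s))\,\mathrm ds ,$$ let $X=\mathbb L_c+\mathbb J$ with $$\mathbb J(t)=\sum_{m=1}^{M(t)}\Big[R_{m-1}(N_{m-1}(T_m))+\sum_{n=0}^{N_{m-1}(T_m)-1}r_{m-1}(n)\Big]+\sum_{n=0}^{N_{M(t)}(t-T^{(+,M(t))})-1}r_{M(t)}(n),$$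 and let $\mathcal F_t$ be the $\sigma$-algebra generated by $M(s)$, $\varepsilon(s)$, $N_{M(s)}(s-T^{(+,M(s))})$ and $X(s)$, $s\le t$. **The transform.** Let $r_*^{(i)}(n),R_*^{(i)}(n)>-1$ be nonrandom, put $c_*^{(i)}(n)=-\lambda^{(i)}_nr_*^{(i)}(n)-\mu^{(i)}_nR_*^{(i)}(n)$, $$\lambda^{(i)}_{*n}=\lambda^{(i)}_n\big(1+r_*^{(i)}(n)\big),\qquad \mu^{(i)}_{*n}=\mu^{(i)}_n\big(1+R_*^{(i)}(n)\big),$$ and assume $\sum_n1/\lambda^{(i)}_{*n}=\infty$, $i\in\{0,1\}$. Let $Z(t)$ be the stochastic exponential $$Z(t)=\mathrm e^{\mathbb L_{c_*}(t)}\prod_{m=1}^{M(t)}\Big[\big(1+R_*^{(\varepsilon_{m-1})}(N_{m-1}(T_m))\big)\prod_{n=0}^{N_{m-1}(T_m)-1}\big(1+r_*^{(\varepsilon_{m-1})}(n)\big)\Big]\prod_{n=0}^{N_{M(t)}(t-T^{(+,M(t))})-1}\big(1+r_*^{(\varepsilon_{M(t)})}(n)\big).$$ **Theorem.** $Z(t)>0$,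 $\mathbb E Z(t)=1$, and $\mathbb E[Z(t)\mathbf 1_A]=\mathbb E[Z(s)\mathbf 1_A]$ for $s\le t$, $A\in\mathcal F_s$, so that $\mathbb P_*(A)=\mathbb E[Z(t)\mathbf 1_A]$, $A\in\mathcal F_t$, $t\ge0$, is well defined. Under $\mathbb P_*$ the state process $\varepsilon$ is governed by independent inter-switching times $T_m\sim\mathrm{PoExp}(\vec\lambda_*^{(\varepsilon_{m-1})},\vec\mu_*^{(\varepsilon_{m-1})})$, in the following sense. 1. For all $k\ge0$, $u_1,\dots,u_k\ge0$ and $t\ge u_1+\dots+u_k$, the event $\{T_1\le u_1,\dots,T_k\le u_k\}$ belongs to $\mathcal F_t$ and $$\mathbb P_*(T_1\le u_1,\dots,T_k\le u_k)=\prod_{m=1}^k\Big(1-\overline F_{\vec\lambda_*^{(\varepsilon_{m-1})},\vec\mu_*^{(\varepsilon_{m-1})}}(u_m)\Big).$$ 2. If $\mathbb P_*$ is given by a probability measure on $(\Omega,\mathcal F)$ and both distributions $\mathrm{PoExp}(\vec\lambda_*^{(i)},\vec\mu_*^{(i)})$, $i\in\{0,1\}$, are proper (their survivor functions tend to $0$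 at infinity), then under this measure $T_1,T_2,\dots$ are independent and $T_m\sim\mathrm{PoExp}(\vec\lambda_*^{(\varepsilon_{m-1})},\vec\mu_*^{(\varepsilon_{m-1})})$ for every $m\ge1$. -/

import Mathlib

open MeasureTheory ProbabilityTheory
open scoped NNReal ENNReal

noncomputable section

/-- Number of shocks up to time `t` when the consecutive inter-shock times are `e 0, e 1, …`:
`N(t) = #{n : e 0 + ⋯ + e n ≤ t}`. -/
def shockCount (e : ℕ → ℝ) (t : ℝ) : ℕ∞ :=
  {n : ℕ | ∑ k ∈ Finset.range (n + 1), e k ≤ t}.encard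

/-- `∫₀ᵗ a(N(s)) ds`.  With `a = μ` this is the accumulated intensity `ξ(t)`, with `a = c` the
piecewise linear motion `l(t)`.  (On the null event `N(s) = ∞` the value `a 0` is used.) -/
def shockIntegral (a : ℕ → ℝ) (e : ℕ → ℝ) (t : ℝ) : ℝ :=
  ∫ s in (0 : ℝ)..t, a (shockCount e s).toNat

/-- Survivor function of the Poisson-modulated exponential distribution `PoExp(lam, mu)`:
`t ↦ E exp(-ξ(t))`, `ξ(t) = ∫₀ᵗ mu_{N(s)} ds`, where the inter-shock times of `N` are independent
with laws `Exp(lam 0), Exp(lam 1), …`. -/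
def poExpSurvival (lam mu : ℕ → ℝ) (t : ℝ) : ℝ :=
  ∫ e, Real.exp (-shockIntegral mu e t) ∂(Measure.infinitePi fun n => expMeasure (lam n))

/-- `T` has distribution `PoExp(lam, mu)` under `Q`.  The value `∞` is allowed, because the
distribution may be improper. -/
def HasPoExpLaw {Ω : Type*} [MeasurableSpace Ω] (Q : Measure Ω) (T : Ω → ℝ≥0∞)
    (lam mu : ℕ → ℝ) : Prop :=
  Measurable T ∧ ∀ t : ℝ≥0, Q.real {ω | (t : ℝ≥0∞) < T ω} = poExpSurvival lam mu t

/-- The pattern during the `m`-th holding period (`m = 0, 1, …`), alternating from `i₀`. -/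
def pattern (i₀ : ZMod 2) (m : ℕ) : ZMod 2 := i₀ + m

/-- The piecewise linear process with two alternating patterns and two kinds of jumps, on a
probability space `(Ω, P)`.

* `i₀` is the initial pattern; `lam i n` are the shock intensities, `mu i n` the switching
  intensities and `c i n` the tendencies in pattern `i` after `n` shocks;
* `τ m n` is the `n`-th inter-shock time of the Poisson process `N_m`;
* `T m` is the length of the `m`-th holding period (the variable usually numbered `m + 1`): given
  `N_m`, it survives `t` with probability `exp (-∫₀ᵗ mu_{N_m(s)} ds)`;
* `r m n` is the jump at the `(n+1)`-st shock of period `m`, and `R m n` the jump at the end of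
  period `m` if `n` shocks occurred in it. -/
structure SwitchingModel {Ω : Type*} [MeasurableSpace Ω] (P : Measure Ω) where
  i₀ : ZMod 2
  lam : ZMod 2 → ℕ → ℝ
  mu : ZMod 2 → ℕ → ℝ
  c : ZMod 2 → ℕ → ℝ
  τ : ℕ → ℕ → Ω → ℝ
  T : ℕ → Ω → ℝ≥0∞
  r : ℕ → ℕ → Ω → ℝ
  R : ℕ → ℕ → Ω → ℝ
  lam_pos : ∀ i n, 0 < lam i n
  mu_pos : ∀ i n, 0 < mu i n
  /-- Shocks do not accumulate in finite time. -/
  lam_nonexplosive : ∀ i, ¬ Summable fun n => (lam i n)⁻¹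
  measurable_τ : ∀ m n, Measurable (τ m n)
  measurable_T : ∀ m, Measurable (T m)
  measurable_r : ∀ m n, Measurable (r m n)
  measurable_R : ∀ m n, Measurable (R m n)
  law_τ : ∀ m n, P.map (τ m n) = expMeasure (lam (pattern i₀ m) n)
  indep_τ : ∀ m, iIndepFun (τ m) P
  /-- `P(T_m > t | N_m) = exp(-ξ_m(t))`. -/
  cond_T : ∀ (m : ℕ) (t : ℝ≥0),
    P[({ω | (t : ℝ≥0∞) < T m ω}.indicator fun _ => (1 : ℝ)) |
        MeasurableSpace.comap (fun ω n => τ m n ω) MeasurableSpace.pi]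
      =ᵐ[P] fun ω => Real.exp (-shockIntegral (mu (pattern i₀ m)) (fun n => τ m n ω) t)
  /-- The holding periods are independent. -/
  indep_periods : iIndepFun (fun (m : ℕ) (ω : Ω) => ((fun n => τ m n ω), T m ω)) P
  /-- The jump amplitudes are independent of the shocks and of the switchings. -/
  indep_jumps : IndepFun (fun ω => ((fun m n => τ m n ω), fun m => T m ω))
    (fun ω => ((fun m n => r m n ω), fun m n => R m n ω)) P

namespace SwitchingModel

variable {Ω : Type*} [MeasurableSpace Ω] {P : Measure Ω} (S : SwitchingModel P)

/-- The instant of the `m`-th switching, the sum of the first `m` holding periods. -/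
def switchTime (m : ℕ) (ω : Ω) : ℝ≥0∞ := ∑ k ∈ Finset.range m, S.T k ω

/-- `M(t)`, the number of switchings up to time `t`. -/
def switchCount (t : ℝ≥0) (ω : Ω) : ℕ∞ :=
  {m : ℕ | S.switchTime (m + 1) ω ≤ t}.encard

/-- `M(t)` as a natural number (`0` on the null event `M(t) = ∞`). -/
def period (t : ℝ≥0) (ω : Ω) : ℕ := (S.switchCount t ω).toNat

/-- The state process `ε(t)`. -/
def state (t : ℝ≥0) (ω : Ω) : ZMod 2 := pattern S.i₀ (S.period t ω)

/-- The time elapsed at `t` since the last switching. -/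
def elapsed (t : ℝ≥0) (ω : Ω) : ℝ := t - (S.switchTime (S.period t ω) ω).toReal

/-- `N_{M(t)}(t - T^{(+,M(t))})`, the number of shocks at `t` since the last switching. -/
def currentShocks (t : ℝ≥0) (ω : Ω) : ℕ∞ :=
  shockCount (fun n => S.τ (S.period t ω) n ω) (S.elapsed t ω)

/-- The number of shocks during the whole `m`-th holding period. -/
def periodShocks (m : ℕ) (ω : Ω) : ℕ :=
  (shockCount (fun n => S.τ m n ω) (S.T m ω).toReal).toNat

/-- The continuous piecewise linear process with tendencies `a`. -/
def drift (a : ZMod 2 → ℕ → ℝ) (t : ℝ≥0) (ω : Ω) : ℝ :=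
  ∑ m ∈ Finset.range (S.period t ω),
      shockIntegral (a (pattern S.i₀ m)) (fun n => S.τ m n ω) (S.T m ω).toReal
    + shockIntegral (a (S.state t ω)) (fun n => S.τ (S.period t ω) n ω) (S.elapsed t ω)

/-- The jump component of the process. -/
def jumps (t : ℝ≥0) (ω : Ω) : ℝ :=
  ∑ m ∈ Finset.range (S.period t ω),
      (S.R m (S.periodShocks m ω) ω + ∑ n ∈ Finset.range (S.periodShocks m ω), S.r m n ω)
    + ∑ n ∈ Finset.range (S.currentShocks t ω).toNat, S.r (S.period t ω) n ω

/-- The piecewise linear process with jumps. -/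
def X (t : ℝ≥0) (ω : Ω) : ℝ := S.drift S.c t ω + S.jumps t ω

/-- `ℱ_t`, generated by the switchings, the states, the shocks and the values of `X` up to time
`t`. -/
@[reducible] def history (t : ℝ≥0) : MeasurableSpace Ω :=
  ⨆ s : Set.Iic t,
    MeasurableSpace.comap (S.switchCount s) ⊤ ⊔ MeasurableSpace.comap (S.state s) ⊤ ⊔
      MeasurableSpace.comap (S.currentShocks s) ⊤ ⊔ MeasurableSpace.comap (S.X s) (borel ℝ)

/-- The tendencies `c_*(n) = -lam_n r_*(n) - mu_n R_*(n)`. -/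
def cStar (rStar RStar : ZMod 2 → ℕ → ℝ) (i : ZMod 2) (n : ℕ) : ℝ :=
  -S.lam i n * rStar i n - S.mu i n * RStar i n

/-- The density `Z(t)`, the stochastic exponential of `𝕃_* + 𝕁_*`: the exponential of the
continuous part `𝕃_*(t)` times the product of `1 + jump` over the jumps of `𝕁_*` up to `t`. -/
def Z (rStar RStar : ZMod 2 → ℕ → ℝ) (t : ℝ≥0) (ω : Ω) : ℝ :=
  Real.exp (S.drift (S.cStar rStar RStar) t ω)
    * (∏ m ∈ Finset.range (S.period t ω),
        ((1 + RStar (pattern S.i₀ m) (S.periodShocks m ω))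
          * ∏ n ∈ Finset.range (S.periodShocks m ω), (1 + rStar (pattern S.i₀ m) n)))
    * ∏ n ∈ Finset.range (S.currentShocks t ω).toNat, (1 + rStar (S.state t ω) n)

/-- The intensities `lam_{*n} = lam_n (1 + r_*(n))`. -/
def lamStar (rStar : ZMod 2 → ℕ → ℝ) (i : ZMod 2) (n : ℕ) : ℝ :=
  S.lam i n * (1 + rStar i n)

/-- The intensities `mu_{*n} = mu_n (1 + R_*(n))`. -/
def muStar (RStar : ZMod 2 → ℕ → ℝ) (i : ZMod 2) (n : ℕ) : ℝ :=
  S.mu i n * (1 + RStar i n)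

end SwitchingModel

end

/-! The variable `Z(t)` is a likelihood ratio. Replacing `Exp(lam n)` by `Exp(lam n * (1 + r n))`
costs the factor `(1 + r n) exp(-lam n r n y)` for a completed inter-shock time `y`, and `exp(-lam n
r n v)` for one only known to exceed `v`. Over the shocks up to `u` these multiply to `exp(-∫ lam r)
∏ (1 + r)`. Given the shocks, survival of the holding period up to `u` has probability `exp(-∫ mu)`,
and its end at `s` has density `mu_N exp(-∫ mu)`; passing to `mu (1 + R)` costs `exp(-∫ mu R)`, and
one more factor `1 + R` if the period has ended. The tendency `-lam r - mu R` collects exactly these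
exponents.

Hence, on the event that `t` lies in period `m`, the intensities can be exchanged one period at a
time (`lintegral_inPeriod_exchange`), and inside a period one shock at a time
(`lintegral_shockLaw_exchange`); both rest on the telescoping lemma `lintegral_infinitePi_exchange`.
Summation over `m` loses no mass because neither shocks nor switchings accumulate, under the old and
under the new law (`ae_regularShocks`, `ae_regularPath`). The jump amplitudes are independent of the
path and do not enter `Z`, so Fubini freezes them.

The outcome is `exists_starLaw`: `E[Z(t); pathData ∈ B] = Q(B)` for one probability measure `Q`,
independent of `t`, and every event `B` of the history up to `t`. Unit mean and consistency follow
at once, and the law of the lengths is read off from `Q`, under which the periods are independent.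
If `P_*` is a measure on `Ω`, the joint distribution function of `T 0, ..., T (k - 1)` is known with
finite bounds on all of them; properness allows superfluous bounds to be sent to infinity, which
gives all marginals and independence. -/

noncomputable section

/-! ### Infinite products: changing the factors one coordinate at a time. -/

section Exchange

variable {α : Type*} [MeasurableSpace α]

/-- Replacing the `j`-th coordinate of an infinite product by an independent one. -/
theorem infinitePi_map_update (μ μ' : ℕ → Measure α) [∀ k, IsProbabilityMeasure (μ k)]
    [∀ k, IsProbabilityMeasure (μ' k)] (j : ℕ) (h : ∀ k, k ≠ j → μ' k = μ k) :
    ((Measure.infinitePi μ').prod (μ j)).map (fun p => Function.update p.1 j p.2)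
      = Measure.infinitePi μ := by
  have hm : Measurable (fun p : (ℕ → α) × α => Function.update p.1 j p.2) := by
    refine measurable_pi_iff.2 fun k => ?_
    by_cases hk : k = j
    · subst hk; simpa using measurable_snd
    · simp only [Function.update_of_ne hk]
      exact (measurable_pi_apply k).comp measurable_fst
  refine Measure.eq_infinitePi _ fun s t ht => ?_
  rw [Measure.map_apply hm (MeasurableSet.pi s.countable_toSet fun i _ => ht i)]
  have hpre : (fun p : (ℕ → α) × α => Function.update p.1 j p.2) ⁻¹' (Set.pi s t)
      = (Set.pi (s.erase j : Finset ℕ) t) ×ˢ (if j ∈ s then t j else Set.univ) := by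
    ext ⟨x, y⟩
    simp only [Set.mem_preimage, Set.mem_pi, Set.mem_prod, Finset.mem_coe, Finset.mem_erase]
    constructor
    · intro H
      refine ⟨fun i hi => ?_, ?_⟩
      · simpa [Function.update_of_ne hi.1] using H i hi.2
      · split_ifs with hj
        · simpa using H j hj
        · trivial
    · rintro ⟨H1, H2⟩ i hi
      by_cases hij : i = j
      · subst hij; simpa [hi] using H2
      · simpa [Function.update_of_ne hij] using H1 i ⟨hij, hi⟩
  rw [hpre, Measure.prod_prod, Measure.infinitePi_pi _ fun i _ => ht i]
  have h1 : ∏ i ∈ s.erase j, μ' i (t i) = ∏ i ∈ s.erase j, μ i (t i) :=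
    Finset.prod_congr rfl fun i hi => by rw [h i (Finset.ne_of_mem_erase hi)]
  rw [h1]
  split_ifs with hj
  · exact Finset.prod_erase_mul _ _ hj
  · rw [Finset.erase_eq_of_notMem hj]; simp

/-- Since coordinate `j` is overwritten, the outer measure may carry any law there. Two products
that differ only at `j` can therefore share the same outer integral. -/
theorem lintegral_infinitePi_update (μ μ' : ℕ → Measure α) [∀ k, IsProbabilityMeasure (μ k)]
    [∀ k, IsProbabilityMeasure (μ' k)] (j : ℕ) (h : ∀ k, k ≠ j → μ' k = μ k)
    {H : (ℕ → α) → ℝ≥0∞} (hH : Measurable H) :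
    ∫⁻ x, H x ∂Measure.infinitePi μ
      = ∫⁻ x, ∫⁻ y, H (Function.update x j y) ∂μ j ∂Measure.infinitePi μ' := by
  have hm : Measurable (fun p : (ℕ → α) × α => Function.update p.1 j p.2) := by
    refine measurable_pi_iff.2 fun k => ?_
    by_cases hk : k = j
    · subst hk; simpa using measurable_snd
    · simp only [Function.update_of_ne hk]
      exact (measurable_pi_apply k).comp measurable_fst
  rw [← infinitePi_map_update μ μ' j h, lintegral_map hH hm]
  exact lintegral_prod _ (hH.comp hm).aemeasurable

/-- Integrals of a function of finitely many coordinates. -/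
theorem lintegral_infinitePi_congr (μ μ' : ℕ → Measure α) [∀ k, IsProbabilityMeasure (μ k)]
    [∀ k, IsProbabilityMeasure (μ' k)] (N : ℕ) (h : ∀ k < N, μ k = μ' k)
    {H : (ℕ → α) → ℝ≥0∞} (hH : Measurable H)
    (hdep : ∀ x x', (∀ k < N, x k = x' k) → H x = H x') :
    ∫⁻ x, H x ∂Measure.infinitePi μ = ∫⁻ x, H x ∂Measure.infinitePi μ' := by
  rcases isEmpty_or_nonempty α with hα | ⟨⟨a⟩⟩
  · have : μ = μ' := by
      funext k
      exact Subsingleton.elim _ _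
    subst this
    rfl
  let ext : ((i : Finset.range N) → α) → ℕ → α :=
    fun z k => if hk : k ∈ Finset.range N then z ⟨k, hk⟩ else a
  have hext : Measurable ext := by
    refine measurable_pi_iff.2 fun k => ?_
    by_cases hk : k ∈ Finset.range N
    · simp only [ext, dif_pos hk]
      exact measurable_pi_apply _
    · simp only [ext, dif_neg hk]
      exact measurable_const
  have key : ∀ (m : ℕ → Measure α) [∀ k, IsProbabilityMeasure (m k)],
      ∫⁻ x, H x ∂Measure.infinitePi m
        = ∫⁻ z, H (ext z) ∂Measure.pi fun i : Finset.range N => m i := by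
    intro m _
    rw [← Measure.infinitePi_map_restrict]
    refine Eq.trans ?_ (lintegral_map (hH.comp hext) (Finset.measurable_restrict _)).symm
    refine lintegral_congr fun x => hdep _ _ fun k hk => ?_
    simp [ext, hk]
  rw [key, key]
  congr 2
  funext i
  exact h i (Finset.mem_range.1 i.2)

/-- Exchanging the factors of an infinite product one at a time. -/
theorem lintegral_infinitePi_exchange (μ μ' : ℕ → Measure α) [∀ k, IsProbabilityMeasure (μ k)]
    [∀ k, IsProbabilityMeasure (μ' k)] (N : ℕ) (H : ℕ → (ℕ → α) → ℝ≥0∞)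
    (hH : ∀ j, Measurable (H j))
    (hstep : ∀ j < N, ∀ x, ∫⁻ y, H j (Function.update x j y) ∂μ j
      = ∫⁻ y, H (j + 1) (Function.update x j y) ∂μ' j)
    (hdep : ∀ x x', (∀ k < N, x k = x' k) → H N x = H N x') :
    ∫⁻ x, H 0 x ∂Measure.infinitePi μ = ∫⁻ x, H N x ∂Measure.infinitePi μ' := by
  -- The hybrid product in which the first `j` factors have already been exchanged.
  let hyb : ℕ → ℕ → Measure α := fun j k => if k < j then μ' k else μ k
  have hprob : ∀ j k, IsProbabilityMeasure (hyb j k) := by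
    intro j k
    dsimp only [hyb]
    split_ifs <;> infer_instance
  have hall : ∀ j ≤ N, ∫⁻ x, H 0 x ∂Measure.infinitePi μ
      = ∫⁻ x, H j x ∂Measure.infinitePi (hyb j) := by
    intro j
    induction j with
    | zero => intro _; simp [hyb]
    | succ j ih =>
      intro hj
      -- Both integrals are disintegrated over coordinate `j` with outer measure `hyb j`, so that
      -- `hstep` compares the inner integrals pointwise.
      rw [ih (by omega), lintegral_infinitePi_update (hyb j) (hyb j) j (fun _ _ => rfl) (hH j),
        lintegral_infinitePi_update (hyb (j + 1)) (hyb j) j (fun k hk => ?_) (hH (j + 1))]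
      · refine lintegral_congr fun x => ?_
        have := hstep j (by omega) x
        simpa [hyb] using this
      · have : k < j + 1 ↔ k < j := by omega
        simp [hyb, this]
  rw [hall N le_rfl]
  -- `hyb N` agrees with `μ'` only below `N`, which is all that `H N` sees.
  exact lintegral_infinitePi_congr _ _ N (fun k hk => by simp [hyb, hk]) (hH N) hdep

/-- Independent `[0, 1]`-valued factors whose mean products tend to zero have products tending to
zero almost surely. -/
theorem ae_iInf_prod_eq_zero (μ : ℕ → Measure α) [∀ k, IsProbabilityMeasure (μ k)]
    (f : ℕ → α → ℝ≥0∞) (hf : ∀ k, Measurable (f k))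
    (h : Filter.Tendsto (fun n => ∏ k ∈ Finset.range n, ∫⁻ y, f k y ∂μ k) Filter.atTop (nhds 0)) :
    ∀ᵐ x ∂Measure.infinitePi μ, ⨅ n, ∏ k ∈ Finset.range n, f k (x k) = 0 := by
  have hmeas : ∀ n, Measurable fun x : ℕ → α => ∏ k ∈ Finset.range n, f k (x k) := fun n =>
    Finset.measurable_prod _ fun k _ => (hf k).comp (measurable_pi_apply k)
  have hint : ∀ n, ∫⁻ x, ∏ k ∈ Finset.range n, f k (x k) ∂Measure.infinitePi μ
      = ∏ k ∈ Finset.range n, ∫⁻ y, f k y ∂μ k := by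
    intro n
    -- With equal measures on both sides, the exchange replaces the factors `f k (x k)` by their
    -- means one by one.
    have := lintegral_infinitePi_exchange μ μ n
      (fun j x => (∏ k ∈ Finset.range (min j n), ∫⁻ y, f k y ∂μ k)
        * ∏ k ∈ Finset.Ico j n, f k (x k)) (fun j => ?_) (fun j hj x => ?_) (fun x x' _ => ?_)
    · simpa [Nat.Ico_zero_eq_range] using this
    · exact (Finset.measurable_prod _ fun k _ =>
        (hf k).comp (measurable_pi_apply k)).const_mul _
    · have e1 : ∀ y, ∏ k ∈ Finset.Ico j n, f k (Function.update x j y k)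
          = f j y * ∏ k ∈ Finset.Ico (j + 1) n, f k (x k) := by
        intro y
        rw [Finset.prod_eq_prod_Ico_succ_bot hj]
        simp only [Function.update_self]
        congr 1
        refine Finset.prod_congr rfl fun k hk => ?_
        rw [Function.update_of_ne]
        have := (Finset.mem_Ico.1 hk).1
        omega
      have e2 : ∀ y, ∏ k ∈ Finset.Ico (j + 1) n, f k (Function.update x j y k)
          = ∏ k ∈ Finset.Ico (j + 1) n, f k (x k) := by
        intro y
        refine Finset.prod_congr rfl fun k hk => ?_
        rw [Function.update_of_ne]
        have := (Finset.mem_Ico.1 hk).1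
        omega
      simp only [e1, e2]
      rw [lintegral_const_mul _ ((hf j).mul_const _), lintegral_mul_const _ (hf j)]
      simp only [lintegral_const, measure_univ, mul_one]
      rw [min_eq_left hj.le, min_eq_left (show j + 1 ≤ n by omega), Finset.prod_range_succ]
      ring
    · simp
  have h0 : ∫⁻ x, ⨅ n, ∏ k ∈ Finset.range n, f k (x k) ∂Measure.infinitePi μ = 0 := by
    refine le_antisymm (ge_of_tendsto h (Filter.Eventually.of_forall fun n => ?_)) zero_le
    rw [← hint n]
    exact lintegral_mono fun x => iInf_le _ n
  rw [lintegral_eq_zero_iff (Measurable.iInf hmeas)] at h0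
  exact h0

end Exchange

/-! ### Deterministic shock sequences: counts, observation up to a time, integrals. -/

section Shocks

/-- The instant of the `n`-th shock (with `arrival e 0 = 0`). -/
def arrival (e : ℕ → ℝ) (n : ℕ) : ℝ := ∑ k ∈ Finset.range n, e k

/-- Positive inter-shock times without accumulation of the shocks. -/
structure RegularShocks (e : ℕ → ℝ) : Prop where
  pos : ∀ n, 0 < e n
  unbounded : ∀ u : ℝ, ∃ n, u < arrival e n

/-- The inter-shock times known at time `u`: those not completed before `u` are replaced by
a value beyond `u`. -/
def observed (u : ℝ) (e : ℕ → ℝ) (k : ℕ) : ℝ :=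
  if (k : ℕ∞) < shockCount e u then e k else u + 1

theorem arrival_succ (e : ℕ → ℝ) (n : ℕ) : arrival e (n + 1) = arrival e n + e n :=
  Finset.sum_range_succ _ _

theorem arrival_nonneg {e : ℕ → ℝ} (he : ∀ n, 0 ≤ e n) (n : ℕ) : 0 ≤ arrival e n :=
  Finset.sum_nonneg fun k _ => he k

theorem arrival_mono {e : ℕ → ℝ} (he : ∀ n, 0 ≤ e n) : Monotone (arrival e) :=
  monotone_nat_of_le_succ fun n => by rw [arrival_succ]; linarith [he n]

theorem lt_shockCount_iff {e : ℕ → ℝ} (he : ∀ n, 0 ≤ e n) (k : ℕ) (t : ℝ) :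
    (k : ℕ∞) < shockCount e t ↔ arrival e (k + 1) ≤ t := by
  constructor
  · intro h
    by_contra hk
    have hsub : {n : ℕ | ∑ k ∈ Finset.range (n + 1), e k ≤ t} ⊆ (Finset.range k : Set ℕ) := by
      intro n hn
      simp only [Finset.coe_range, Set.mem_Iio]
      by_contra hkn
      exact hk ((arrival_mono he (by omega : k + 1 ≤ n + 1)).trans hn)
    have := Set.encard_le_encard hsub
    rw [Set.encard_coe_eq_coe_finsetCard, Finset.card_range] at this
    exact absurd h (not_lt.2 this)
  · intro h
    have hsub : (Finset.range (k + 1) : Set ℕ) ⊆ {n : ℕ | ∑ k ∈ Finset.range (n + 1), e k ≤ t} := by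
      intro n hn
      simp only [Finset.coe_range, Set.mem_Iio] at hn
      exact (arrival_mono he (by omega : n + 1 ≤ k + 1)).trans h
    have := Set.encard_le_encard hsub
    rw [Set.encard_coe_eq_coe_finsetCard, Finset.card_range] at this
    refine lt_of_lt_of_le ?_ this
    exact_mod_cast Nat.lt_succ_self k

theorem shockCount_eq_coe {e : ℕ → ℝ} (he : ∀ n, 0 ≤ e n) {n : ℕ} {t : ℝ}
    (h1 : arrival e n ≤ t) (h2 : t < arrival e (n + 1)) : shockCount e t = n := by
  refine le_antisymm (not_lt.1 fun h => not_le.2 h2 ((lt_shockCount_iff he n t).1 h)) ?_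
  cases n with
  | zero => simp
  | succ m =>
    have := (lt_shockCount_iff he m t).2 h1
    exact_mod_cast Order.add_one_le_of_lt this

theorem shockCount_mono (e : ℕ → ℝ) : Monotone (shockCount e) := fun _ _ h =>
  Set.encard_le_encard fun _ hn => le_trans hn h

theorem RegularShocks.exists_count {e : ℕ → ℝ} (he : RegularShocks e) {t : ℝ} (ht : 0 ≤ t) :
    ∃ n : ℕ, arrival e n ≤ t ∧ t < arrival e (n + 1) ∧ shockCount e t = n := by
  classical
  have hex := he.unbounded t
  have hpos : 0 < Nat.find hex := by
    rw [Nat.find_pos]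
    simpa [arrival] using ht
  obtain ⟨n, hn⟩ := Nat.exists_eq_succ_of_ne_zero hpos.ne'
  have h1 : arrival e n ≤ t := not_lt.1 (Nat.find_min hex (by omega))
  have h2 : t < arrival e (n + 1) := by
    have := Nat.find_spec hex
    rwa [hn] at this
  exact ⟨n, h1, h2, shockCount_eq_coe (fun k => (he.pos k).le) h1 h2⟩

theorem RegularShocks.shockCount_ne_top {e : ℕ → ℝ} (he : RegularShocks e) (t : ℝ) :
    shockCount e t ≠ ⊤ := by
  obtain ⟨n, -, -, hn⟩ := he.exists_count (le_max_right t 0)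
  exact ne_top_of_le_ne_top (by rw [hn]; exact ENat.natCast_ne_top n)
    (shockCount_mono e (le_max_left t 0))

theorem arrival_observed {e : ℕ → ℝ} {u : ℝ} {k : ℕ} (hk : (k : ℕ∞) < shockCount e u) : arrival (observed u e) (k + 1) = arrival e (k + 1) := by
  refine Finset.sum_congr rfl fun j hj => ?_
  have hjk : (j : ℕ∞) ≤ k := by
    exact_mod_cast Nat.lt_succ_iff.1 (Finset.mem_range.1 hj)
  exact if_pos (lt_of_le_of_lt hjk hk)

/-- What is observed at `u` determines the shock count up to `u`. -/
theorem shockCount_observed {e : ℕ → ℝ} (he : ∀ n, 0 ≤ e n) {u s : ℝ} (hu : 0 ≤ u) (hs : s ≤ u) :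
    shockCount (observed u e) s = shockCount e s := by
  have ho : ∀ n, 0 ≤ observed u e n := by
    intro n
    unfold observed
    split_ifs
    · exact he n
    · linarith
  unfold shockCount
  congr 1
  ext k
  simp only [Set.mem_ofPred_eq]
  change arrival (observed u e) (k + 1) ≤ s ↔ arrival e (k + 1) ≤ s
  by_cases hk : (k : ℕ∞) < shockCount e u
  · rw [arrival_observed hk]
  · have h1 : ¬ arrival e (k + 1) ≤ s := fun h =>
      hk ((lt_shockCount_iff he k u).2 (h.trans hs))
    have h2 : ¬ arrival (observed u e) (k + 1) ≤ s := by
      rw [arrival_succ]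
      have h3 : observed u e k = u + 1 := if_neg hk
      have h4 := arrival_nonneg ho k
      rw [h3]
      linarith
    exact iff_of_false h2 h1

theorem shockIntegral_congr {a : ℕ → ℝ} {e e' : ℕ → ℝ} {t : ℝ} (ht : 0 ≤ t)
    (h : ∀ s ≤ t, shockCount e s = shockCount e' s) :
    shockIntegral a e t = shockIntegral a e' t := by
  refine intervalIntegral.integral_congr fun s hs => ?_
  rw [Set.uIcc_of_le ht] at hs
  simp only [h s hs.2]

theorem shockIntegral_observed {a : ℕ → ℝ} {e : ℕ → ℝ} (he : ∀ n, 0 ≤ e n) {u t : ℝ}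
    (ht : 0 ≤ t) (htu : t ≤ u) : shockIntegral a (observed u e) t = shockIntegral a e t :=
  shockIntegral_congr ht fun _ hs => shockCount_observed he (ht.trans htu) (hs.trans htu)

theorem measurable_arrival (n : ℕ) : Measurable fun e : ℕ → ℝ => arrival e n :=
  Finset.measurable_sum _ fun k _ => measurable_pi_apply k

theorem measurable_shockCount :
    Measurable fun p : (ℕ → ℝ) × ℝ => shockCount p.1 p.2 := by
  refine measurable_encard.comp (measurable_set_iff.2 fun n => ?_)
  have h1 : Measurable fun p : (ℕ → ℝ) × ℝ => ∑ k ∈ Finset.range (n + 1), p.1 k :=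
    (measurable_arrival (n + 1)).comp measurable_fst
  exact measurable_to_prop (by simpa using! measurableSet_le h1 measurable_snd)

theorem measurable_rate (a : ℕ → ℝ) :
    Measurable fun p : (ℕ → ℝ) × ℝ => a (shockCount p.1 p.2).toNat := by
  have h : Measurable fun m : ℕ∞ => a m.toNat := measurable_of_countable _
  exact h.comp measurable_shockCount

theorem RegularShocks.exists_rate_bound {e : ℕ → ℝ} (he : RegularShocks e) (a : ℕ → ℝ) (y : ℝ) :
    ∃ C, ∀ s ≤ y, |a (shockCount e s).toNat| ≤ C := by
  obtain ⟨n, hn⟩ := ENat.ne_top_iff_exists.1 (he.shockCount_ne_top y)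
  refine ⟨∑ k ∈ Finset.range (n + 1), |a k|, fun s hs => ?_⟩
  have h1 : shockCount e s ≤ n := by rw [hn]; exact shockCount_mono e hs
  have h2 : (shockCount e s).toNat ≤ n := ENat.toNat_le_of_le_natCast h1
  generalize (shockCount e s).toNat = k at h2
  exact Finset.single_le_sum (f := fun k => |a k|) (fun k _ => abs_nonneg (a k))
    (Finset.mem_range.2 (Nat.lt_succ_of_le h2))

theorem RegularShocks.intervalIntegrable {e : ℕ → ℝ} (he : RegularShocks e) (a : ℕ → ℝ) (x y : ℝ) :
    IntervalIntegrable (fun s => a (shockCount e s).toNat) volume x y := by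
  obtain ⟨C, hC⟩ := he.exists_rate_bound a (max x y)
  have hprod : Measurable fun s : ℝ => ((e, s) : (ℕ → ℝ) × ℝ) := measurable_prodMk_left
  have hmeas := (measurable_rate a).comp hprod
  simp only [Function.comp_def] at hmeas
  have hconst : IntervalIntegrable (fun _ : ℝ => C) volume x y := intervalIntegrable_const
  refine hconst.mono_fun' hmeas.aestronglyMeasurable ?_
  refine (ae_restrict_iff' measurableSet_uIoc).2 (Filter.Eventually.of_forall fun s hs => ?_)
  exact hC s ((Set.mem_uIoc.1 hs).elim (fun h => h.2.trans (le_max_right _ _))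
    (fun h => h.2.trans (le_max_left _ _)))

theorem RegularShocks.shockIntegral_sub {e : ℕ → ℝ} (he : RegularShocks e) (a : ℕ → ℝ)
    (x y : ℝ) : shockIntegral a e y - shockIntegral a e x
      = ∫ s in x..y, a (shockCount e s).toNat :=
  intervalIntegral.integral_interval_sub_left (he.intervalIntegrable a _ _)
    (he.intervalIntegrable a _ _)

theorem RegularShocks.shockIntegral_sub_of_le {e : ℕ → ℝ} (he : RegularShocks e) (a : ℕ → ℝ)
    {n : ℕ} {x y : ℝ} (hx : arrival e n ≤ x) (hxy : x ≤ y) (hy : y ≤ arrival e (n + 1)) :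
    shockIntegral a e y - shockIntegral a e x = a n * (y - x) := by
  -- The right endpoint is discarded because the count jumps at `y` when `y = arrival e (n + 1)`.
  rw [he.shockIntegral_sub, intervalIntegral.integral_of_le hxy,
    integral_Ioc_eq_integral_Ioo]
  rw [setIntegral_congr_fun (g := fun _ => a n) measurableSet_Ioo fun s hs => ?_]
  · simp [hxy, mul_comm]
  · have : shockCount e s = n := shockCount_eq_coe (fun k => (he.pos k).le) (hx.trans hs.1.le)
      (lt_of_lt_of_le hs.2 hy)
    simp [this]

/-- The integral along the shocks as a finite sum. -/
theorem RegularShocks.shockIntegral_eq {e : ℕ → ℝ} (he : RegularShocks e) (a : ℕ → ℝ) {n : ℕ}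
    {u : ℝ} (h1 : arrival e n ≤ u) (h2 : u ≤ arrival e (n + 1)) :
    shockIntegral a e u = ∑ k ∈ Finset.range n, a k * e k + a n * (u - arrival e n) := by
  have key : ∀ m, shockIntegral a e (arrival e m) = ∑ k ∈ Finset.range m, a k * e k := by
    intro m
    induction m with
    | zero => simp [arrival, shockIntegral]
    | succ m ih =>
      have := he.shockIntegral_sub_of_le a le_rfl
        (arrival_mono (fun k => (he.pos k).le) (Nat.le_succ m)) le_rfl
      rw [Finset.sum_range_succ, ← ih]
      have h3 := arrival_succ e m
      rw [show arrival e (m.succ) = arrival e (m + 1) from rfl] at this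
      rw [h3] at this ⊢
      linarith [this]
  have := he.shockIntegral_sub_of_le a le_rfl h1 h2
  rw [key] at this
  linarith

theorem RegularShocks.shockIntegral_add {e : ℕ → ℝ} (he : RegularShocks e) (a b : ℕ → ℝ) (u : ℝ) :
    shockIntegral (fun n => a n + b n) e u = shockIntegral a e u + shockIntegral b e u :=
  intervalIntegral.integral_add (he.intervalIntegrable a _ _) (he.intervalIntegrable b _ _)

theorem shockIntegral_neg (a : ℕ → ℝ) (e : ℕ → ℝ) (u : ℝ) :
    shockIntegral (fun n => -a n) e u = -shockIntegral a e u :=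
  intervalIntegral.integral_neg

theorem shockIntegral_zero (a e : ℕ → ℝ) : shockIntegral a e 0 = 0 :=
  intervalIntegral.integral_same

theorem RegularShocks.continuous_shockIntegral {e : ℕ → ℝ} (he : RegularShocks e) (a : ℕ → ℝ) :
    Continuous (shockIntegral a e) :=
  intervalIntegral.continuous_primitive (he.intervalIntegrable a) 0

theorem RegularShocks.shockIntegral_mono {e : ℕ → ℝ} (he : RegularShocks e) {a : ℕ → ℝ}
    (ha : ∀ n, 0 ≤ a n) : Monotone (shockIntegral a e) := fun x y hxy => by
  have := he.shockIntegral_sub a x y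
  have h2 : 0 ≤ ∫ s in x..y, a (shockCount e s).toNat :=
    intervalIntegral.integral_nonneg_of_forall hxy fun s => ha _
  linarith

/-- The rate is constant from `x` until the next shock but may jump at `x`, so in general only a
right derivative exists. It is enough for the fundamental theorem of calculus in
`RegularShocks.integral_density`. -/
theorem RegularShocks.hasDerivWithinAt_shockIntegral {e : ℕ → ℝ} (he : RegularShocks e)
    (a : ℕ → ℝ) {x : ℝ} (hx : 0 ≤ x) :
    HasDerivWithinAt (shockIntegral a e) (a (shockCount e x).toNat) (Set.Ioi x) x := by
  obtain ⟨n, h1, h2, hn⟩ := he.exists_count hx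
  have hlin : HasDerivWithinAt (fun y => shockIntegral a e x + a n * (y - x)) (a n)
      (Set.Ioi x) x := by
    have := ((hasDerivWithinAt_id x (Set.Ioi x)).sub_const x).const_mul (a n)
    simpa using this.const_add (shockIntegral a e x)
  rw [hn, ENat.toNat_natCast]
  refine hlin.congr_of_eventuallyEq ?_ (by simp)
  filter_upwards [Ioo_mem_nhdsGT h2] with y hy
  have := he.shockIntegral_sub_of_le a h1 hy.1.le hy.2.le
  linarith

/-- `exp (-ξ)` is the tail of the density `a_N exp (-ξ)`. -/
theorem RegularShocks.integral_density {e : ℕ → ℝ} (he : RegularShocks e) (a : ℕ → ℝ)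
    {u : ℝ} (hu : 0 ≤ u) :
    ∫ s in (0 : ℝ)..u, a (shockCount e s).toNat * Real.exp (-shockIntegral a e s)
      = 1 - Real.exp (-shockIntegral a e u) := by
  have hcont : Continuous fun s => Real.exp (-shockIntegral a e s) :=
    Real.continuous_exp.comp (he.continuous_shockIntegral a).neg
  have := intervalIntegral.integral_eq_sub_of_hasDeriv_right (a := 0) (b := u)
    (f := fun s => -Real.exp (-shockIntegral a e s))
    (f' := fun s => a (shockCount e s).toNat * Real.exp (-shockIntegral a e s))
    hcont.neg.continuousOn (fun s hs => ?_)
    ((he.intervalIntegrable a 0 u).mul_continuousOn hcont.continuousOn)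
  · rw [this, shockIntegral_zero]
    simp
    ring
  · rw [min_eq_left hu] at hs
    have := ((he.hasDerivWithinAt_shockIntegral a hs.1.le).neg.exp).neg
    convert! this using 1
    simp only [Pi.neg_apply]
    ring

end Shocks

/-! ### Joint measurability in the shocks and the time. -/

section Measurability

theorem measurable_shockIntegral (a : ℕ → ℝ) :
    Measurable fun p : (ℕ → ℝ) × ℝ => shockIntegral a p.1 p.2 := by
  have hN : Measurable fun q : ((ℕ → ℝ) × ℝ) × ℝ => a (shockCount q.1.1 q.2).toNat :=
    (measurable_rate a).comp ((measurable_fst.comp measurable_fst).prodMk measurable_snd)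
  have key : ∀ S : Set (((ℕ → ℝ) × ℝ) × ℝ), MeasurableSet S →
      Measurable fun p : (ℕ → ℝ) × ℝ =>
        ∫ s, S.indicator (fun q => a (shockCount q.1.1 q.2).toNat) (p, s) := fun S hS =>
    ((hN.indicator hS).stronglyMeasurable.integral_prod_right').measurable
  -- The moving limits of integration become measurable sets in the product space, one for each
  -- orientation of the interval integral.
  have hS1 : MeasurableSet {q : ((ℕ → ℝ) × ℝ) × ℝ | 0 < q.2 ∧ q.2 ≤ q.1.2} :=
    (measurableSet_lt measurable_const measurable_snd).inter
      (measurableSet_le measurable_snd (measurable_snd.comp measurable_fst))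
  have hS2 : MeasurableSet {q : ((ℕ → ℝ) × ℝ) × ℝ | q.1.2 < q.2 ∧ q.2 ≤ 0} :=
    (measurableSet_lt (measurable_snd.comp measurable_fst) measurable_snd).inter
      (measurableSet_le measurable_snd measurable_const)
  convert! (key _ hS1).sub (key _ hS2) using 1
  funext p
  simp only [shockIntegral, intervalIntegral]
  rw [← integral_indicator measurableSet_Ioc, ← integral_indicator measurableSet_Ioc]
  rfl

theorem measurable_observed :
    Measurable fun p : ℝ × (ℕ → ℝ) => observed p.1 p.2 := by
  refine measurable_pi_iff.2 fun k => ?_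
  have h : MeasurableSet {p : ℝ × (ℕ → ℝ) | (k : ℕ∞) < shockCount p.2 p.1} :=
    (measurable_shockCount.comp (measurable_snd.prodMk measurable_fst))
      (MeasurableSet.of_discrete (s := {m : ℕ∞ | (k : ℕ∞) < m}))
  exact Measurable.ite h ((measurable_pi_apply k).comp measurable_snd)
    (measurable_fst.add_const 1)

theorem measurableSet_regularShocks : MeasurableSet {e : ℕ → ℝ | RegularShocks e} := by
  have : {e : ℕ → ℝ | RegularShocks e}
      = (⋂ n : ℕ, {e | 0 < e n}) ∩ ⋂ m : ℕ, ⋃ n : ℕ, {e | (m : ℝ) < arrival e n} := by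
    ext e
    simp only [Set.mem_ofPred_eq, Set.mem_inter_iff, Set.mem_iInter, Set.mem_iUnion]
    constructor
    · exact fun h => ⟨h.pos, fun m => h.unbounded m⟩
    · rintro ⟨h1, h2⟩
      refine ⟨h1, fun u => ?_⟩
      obtain ⟨m, hm⟩ := exists_nat_gt u
      obtain ⟨n, hn⟩ := h2 m
      exact ⟨n, hm.trans hn⟩
  rw [this]
  refine (MeasurableSet.iInter fun n => ?_).inter
    (MeasurableSet.iInter fun m => MeasurableSet.iUnion fun n => ?_)
  · exact measurableSet_lt measurable_const (measurable_pi_apply n)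
  · exact measurableSet_lt measurable_const (measurable_arrival n)

end Measurability

/-! ### Measurability of composed functionals and of sums and products of random length. -/

section MeasurabilityComp

variable {β : Type*} [MeasurableSpace β]

@[fun_prop]
theorem Measurable.shockCount {f : β → ℕ → ℝ} {g : β → ℝ} (hf : Measurable f)
    (hg : Measurable g) : Measurable fun x => shockCount (f x) (g x) := by
  have := measurable_shockCount.comp (hf.prodMk hg)
  simpa only [Function.comp_def] using this

@[fun_prop]
theorem Measurable.shockIntegral {a : ℕ → ℝ} {f : β → ℕ → ℝ} {g : β → ℝ} (hf : Measurable f)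
    (hg : Measurable g) : Measurable fun x => shockIntegral a (f x) (g x) := by
  have := (measurable_shockIntegral a).comp (hf.prodMk hg)
  simpa only [Function.comp_def] using this

@[fun_prop]
theorem Measurable.observed {f : β → ℕ → ℝ} {g : β → ℝ} (hf : Measurable f)
    (hg : Measurable g) : Measurable fun x => observed (g x) (f x) := by
  have := measurable_observed.comp (hg.prodMk hf)
  simpa only [Function.comp_def] using this

@[fun_prop]
theorem Measurable.enat_comp {γ : Type*} [MeasurableSpace γ] {f : β → ℕ∞} (hf : Measurable f)
    (a : ℕ∞ → γ) : Measurable fun x => a (f x) := by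
  have h : Measurable a := measurable_of_countable _
  exact h.comp hf

theorem measurable_prod_range {f : β → ℕ} (hf : Measurable f) {g : ℕ → β → ℝ}
    (hg : ∀ n, Measurable (g n)) : Measurable fun x => ∏ n ∈ Finset.range (f x), g n x := by
  have h : Measurable fun p : ℕ × β => ∏ n ∈ Finset.range p.1, g n p.2 :=
    measurable_from_prod_countable_right fun m =>
      Finset.measurable_prod (Finset.range m) fun n _ => hg n
  exact h.comp (hf.prodMk measurable_id)

theorem measurable_sum_range {f : β → ℕ} (hf : Measurable f) {g : ℕ → β → ℝ}
    (hg : ∀ n, Measurable (g n)) : Measurable fun x => ∑ n ∈ Finset.range (f x), g n x := by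
  have h : Measurable fun p : ℕ × β => ∑ n ∈ Finset.range p.1, g n p.2 :=
    measurable_from_prod_countable_right fun m =>
      Finset.measurable_sum (Finset.range m) fun n _ => hg n
  exact h.comp (hf.prodMk measurable_id)

end MeasurabilityComp

/-! ### Exponential laws: tilting, tails, Laplace transform. -/

section Exponential

theorem expMeasure_eq_withDensity (l : ℝ) :
    expMeasure l = volume.withDensity (exponentialPDF l) := rfl

theorem measurable_exponentialPDF (l : ℝ) : Measurable (exponentialPDF l) :=
  (measurable_exponentialPDFReal l).ennreal_ofReal

theorem ae_expMeasure_pos (l : ℝ) : ∀ᵐ y ∂expMeasure l, 0 < y := by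
  rw [expMeasure_eq_withDensity, ae_withDensity_iff (measurable_exponentialPDF l)]
  have h0 : ∀ᵐ y : ℝ, y ≠ 0 := by simp [ae_iff]
  filter_upwards [h0] with y hy h
  by_contra hneg
  exact h (exponentialPDF_of_neg (lt_of_le_of_ne (not_lt.1 hneg) hy))

/-- Exponential change of the intensity. -/
theorem lintegral_expMeasure_tilt {l r : ℝ} (hl : 0 < l) (hr : -1 < r) {φ : ℝ → ℝ≥0∞}
    (hφ : Measurable φ) :
    ∫⁻ y, ENNReal.ofReal ((1 + r) * Real.exp (-(l * r * y))) * φ y ∂expMeasure l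
      = ∫⁻ y, φ y ∂expMeasure (l * (1 + r)) := by
  have hr' : 0 < 1 + r := by linarith
  rw [expMeasure_eq_withDensity, expMeasure_eq_withDensity,
    lintegral_withDensity_eq_lintegral_mul _ (measurable_exponentialPDF l) (by fun_prop),
    lintegral_withDensity_eq_lintegral_mul _ (measurable_exponentialPDF _) hφ]
  refine lintegral_congr fun y => ?_
  simp only [Pi.mul_apply]
  rw [← mul_assoc]
  congr 1
  rcases lt_or_ge y 0 with hy | hy
  · simp [exponentialPDF_of_neg hy]
  · rw [exponentialPDF_of_nonneg hy, exponentialPDF_of_nonneg hy,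
      ← ENNReal.ofReal_mul (by positivity)]
    congr 1
    rw [show -(l * (1 + r) * y) = -(l * y) + -(l * r * y) by ring, Real.exp_add]
    ring

theorem expMeasure_Ioi {l : ℝ} (hl : 0 < l) {v : ℝ} (hv : 0 ≤ v) :
    expMeasure l (Set.Ioi v) = ENNReal.ofReal (Real.exp (-(l * v))) := by
  have := isProbabilityMeasure_expMeasure hl
  have hle : Real.exp (-(l * v)) ≤ 1 := Real.exp_le_one_iff.2 (by
    have := mul_nonneg hl.le hv; linarith)
  have h1 : expMeasure l (Set.Iic v) = ENNReal.ofReal (1 - Real.exp (-(l * v))) := by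
    rw [expMeasure_eq_withDensity, withDensity_apply _ measurableSet_Iic,
      lintegral_exponentialPDF_eq_antiDeriv hl, if_pos hv]
  rw [← Set.compl_Iic, prob_compl_eq_one_sub measurableSet_Iic, h1, ← ENNReal.ofReal_one,
    ← ENNReal.ofReal_sub _ (by linarith)]
  congr 1
  ring

/-- Tilting with `r = l⁻¹` makes `l * r * y = y`, so the unit mass of the tilted law gives the
Laplace transform at `1`. -/
theorem lintegral_exp_neg_expMeasure {l : ℝ} (hl : 0 < l) :
    ∫⁻ y, ENNReal.ofReal (Real.exp (-y)) ∂expMeasure l = ENNReal.ofReal ((1 + l⁻¹)⁻¹) := by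
  have hl' : 0 < l⁻¹ := inv_pos.2 hl
  have hpos : 0 < 1 + l⁻¹ := by linarith
  have := isProbabilityMeasure_expMeasure (mul_pos hl hpos)
  have h := lintegral_expMeasure_tilt hl (show -1 < l⁻¹ by linarith) (φ := fun _ => 1)
    measurable_const
  simp only [mul_inv_cancel₀ hl.ne', one_mul, mul_one, lintegral_const, measure_univ] at h
  simp only [ENNReal.ofReal_mul hpos.le] at h
  rw [lintegral_const_mul _ (by fun_prop)] at h
  rw [ENNReal.ofReal_inv_of_pos hpos]
  rw [mul_comm] at h
  exact ENNReal.eq_inv_of_mul_eq_one_left h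

end Exponential

/-! ### The law of the shocks: no accumulation, and change of the shock intensities. -/

section ShockLaw

/-- The joint law of the inter-shock times. -/
abbrev shockLaw (lam : ℕ → ℝ) : Measure (ℕ → ℝ) :=
  Measure.infinitePi fun n => expMeasure (lam n)

/-- Expanding the product shows `∏ (1 + x k) ≥ 1 + ∑ x k`, which diverges. -/
theorem tendsto_prod_inv_one_add {x : ℕ → ℝ} (hx : ∀ n, 0 ≤ x n) (hs : ¬ Summable x) :
    Filter.Tendsto (fun n => ∏ k ∈ Finset.range n, (1 + x k)⁻¹) Filter.atTop (nhds 0) := by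
  have h1 := (not_summable_iff_tendsto_nat_atTop_of_nonneg hx).1 hs
  have h2 : ∀ n, ∑ k ∈ Finset.range n, x k ≤ ∏ k ∈ Finset.range n, (1 + x k) := by
    intro n
    have : 1 + ∑ k ∈ Finset.range n, x k ≤ ∏ k ∈ Finset.range n, (1 + x k) := by
      induction n with
      | zero => simp
      | succ n ih =>
        rw [Finset.sum_range_succ, Finset.prod_range_succ]
        have h3 : 0 ≤ ∑ k ∈ Finset.range n, x k := Finset.sum_nonneg fun k _ => hx k
        nlinarith [hx n, mul_nonneg h3 (hx n), mul_le_mul_of_nonneg_right ih (hx n)]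
    linarith
  have h3 := Filter.tendsto_atTop_mono h2 h1
  refine h3.inv_tendsto_atTop.congr fun n => ?_
  simp [Finset.prod_inv_distrib]

/-- By independence `E exp(-arrival e n) = ∏ (1 + 1 / lam k)⁻¹`, and this tends to zero because `∑ 1
/ lam k` diverges. Hence `exp(-arrival e n)` has infimum zero almost surely, so the arrivals are
unbounded. -/
theorem ae_regularShocks {lam : ℕ → ℝ} (hlam : ∀ n, 0 < lam n)
    (hs : ¬ Summable fun n => (lam n)⁻¹) : ∀ᵐ e ∂shockLaw lam, RegularShocks e := by
  have := fun n => isProbabilityMeasure_expMeasure (hlam n)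
  have hpos : ∀ᵐ e ∂shockLaw lam, ∀ n, 0 < e n := by
    refine ae_all_iff.2 fun n => ?_
    have h := ae_expMeasure_pos (lam n)
    rw [← Measure.infinitePi_map_eval (fun n => expMeasure (lam n)) n] at h
    exact ae_of_ae_map (measurable_pi_apply n).aemeasurable h
  have hzero := ae_iInf_prod_eq_zero (fun n => expMeasure (lam n))
    (fun _ y => ENNReal.ofReal (Real.exp (-y))) (fun _ => by fun_prop) (by
      have h := tendsto_prod_inv_one_add (fun n => (inv_pos.2 (hlam n)).le) hs
      have h2 := ENNReal.tendsto_ofReal h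
      simp only [ENNReal.ofReal_zero] at h2
      refine h2.congr fun n => ?_
      rw [ENNReal.ofReal_prod_of_nonneg fun k _ => by
        have := inv_pos.2 (hlam k)
        positivity]
      exact Finset.prod_congr rfl fun k _ => (lintegral_exp_neg_expMeasure (hlam k)).symm)
  filter_upwards [hpos, hzero] with e h1 h2
  refine ⟨h1, fun u => ?_⟩
  have h3 : ⨅ n, ∏ k ∈ Finset.range n, ENNReal.ofReal (Real.exp (-e k))
      < ENNReal.ofReal (Real.exp (-u)) := by
    rw [h2]
    exact ENNReal.ofReal_pos.2 (Real.exp_pos _)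
  obtain ⟨n, hn⟩ := iInf_lt_iff.1 h3
  refine ⟨n, ?_⟩
  rw [← ENNReal.ofReal_prod_of_nonneg fun k _ => (Real.exp_pos _).le, ← Real.exp_sum,
    ENNReal.ofReal_lt_ofReal_iff (Real.exp_pos _), Real.exp_lt_exp, Finset.sum_neg_distrib] at hn
  unfold arrival
  linarith

/-- The first `n` inter-shock times, continued by `u + 1`. -/
def truncated (n : ℕ) (u : ℝ) (e : ℕ → ℝ) (k : ℕ) : ℝ := if k < n then e k else u + 1

theorem observed_eq_truncated {e : ℕ → ℝ} {u : ℝ} {n : ℕ} (h : shockCount e u = n) :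
    observed u e = truncated n u e := by
  funext k
  simp [observed, truncated, h]

theorem measurable_truncated (n : ℕ) (u : ℝ) : Measurable (truncated n u) := by
  refine measurable_pi_iff.2 fun k => ?_
  unfold truncated
  split_ifs <;> fun_prop

theorem truncated_congr {n : ℕ} {u : ℝ} {e e' : ℕ → ℝ} (h : ∀ k < n, e k = e' k) :
    truncated n u e = truncated n u e' := by
  funext k
  unfold truncated
  split_ifs with hk
  · exact h k hk
  · rfl

theorem arrival_congr {n : ℕ} {e e' : ℕ → ℝ} (h : ∀ k < n, e k = e' k) :
    arrival e n = arrival e' n :=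
  Finset.sum_congr rfl fun k hk => h k (Finset.mem_range.1 hk)

theorem measurableSet_arrival (n : ℕ) (u : ℝ) :
    MeasurableSet {e : ℕ → ℝ | arrival e n ≤ u ∧ u < arrival e (n + 1)} :=
  (measurableSet_le (measurable_arrival n) measurable_const).inter
    (measurableSet_lt measurable_const (measurable_arrival (n + 1)))

/-- The density for the change of the shock intensities, on the event of `n` shocks. -/
theorem lintegral_shockLaw_exchange {lam r : ℕ → ℝ} (hlam : ∀ n, 0 < lam n) (hr : ∀ n, -1 < r n)
    (u : ℝ) (n : ℕ) {G : (ℕ → ℝ) → ℝ≥0∞} (hG : Measurable G) :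
    ∫⁻ e, {e | arrival e n ≤ u ∧ u < arrival e (n + 1)}.indicator (fun e =>
        (∏ k ∈ Finset.range n, ENNReal.ofReal ((1 + r k) * Real.exp (-(lam k * r k * e k))))
          * ENNReal.ofReal (Real.exp (-(lam n * r n * (u - arrival e n))))
          * G (truncated n u e)) e ∂shockLaw lam
      = ∫⁻ e, {e | arrival e n ≤ u ∧ u < arrival e (n + 1)}.indicator
        (fun e => G (truncated n u e)) e ∂shockLaw fun n => lam n * (1 + r n) := by
  have hlam' : ∀ n, 0 < lam n * (1 + r n) := fun n => mul_pos (hlam n) (by linarith [hr n])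
  have := fun n => isProbabilityMeasure_expMeasure (hlam n)
  have := fun n => isProbabilityMeasure_expMeasure (hlam' n)
  let E : Set (ℕ → ℝ) := {e | arrival e n ≤ u ∧ u < arrival e (n + 1)}
  have hE : MeasurableSet E := measurableSet_arrival n u
  let w : ℕ → ℝ → ℝ≥0∞ := fun k y => ENNReal.ofReal ((1 + r k) * Real.exp (-(lam k * r k * y)))
  let z : (ℕ → ℝ) → ℝ≥0∞ :=
    fun e => ENNReal.ofReal (Real.exp (-(lam n * r n * (u - arrival e n))))
  have hz : Measurable z := by
    have := measurable_arrival n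
    fun_prop
  have hGt : Measurable fun e => G (truncated n u e) := hG.comp (measurable_truncated n u)
  have hw : ∀ k, Measurable (w k) := fun k => by fun_prop
  -- `n` shocks by time `u` involve `n + 1` inter-shock times: the weight of each of the first `n`
  -- is spent when its law is exchanged, and `z` is spent on the last one, which is only known to
  -- outlast `u`.
  have key := lintegral_infinitePi_exchange (fun n => expMeasure (lam n))
    (fun n => expMeasure (lam n * (1 + r n))) (n + 1)
    (fun j => E.indicator fun e => (∏ k ∈ Finset.Ico j n, w k (e k))
      * (if j ≤ n then z e else 1) * G (truncated n u e))
    (fun j => ?_) (fun j hj x => ?_) (fun x x' h => ?_)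
  · simpa [Nat.Ico_zero_eq_range] using key
  · refine Measurable.indicator (Measurable.mul (Measurable.mul ?_ ?_) hGt) hE
    · exact Finset.measurable_prod _ fun k _ => (hw k).comp (measurable_pi_apply k)
    · split_ifs
      · exact hz
      · exact measurable_const
  · have hupd : Measurable fun y : ℝ => Function.update x j y := measurable_update x
    rcases Nat.lt_succ_iff_lt_or_eq.1 hj with hjn | rfl
    · refine Eq.trans ?_ (lintegral_expMeasure_tilt (hlam j) (hr j) (φ := fun y =>
        E.indicator (fun e => (∏ k ∈ Finset.Ico (j + 1) n, w k (e k))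
          * (if j + 1 ≤ n then z e else 1) * G (truncated n u e)) (Function.update x j y)) ?_)
      · refine lintegral_congr fun y => ?_
        by_cases hy : Function.update x j y ∈ E
        · rw [Set.indicator_of_mem hy, Set.indicator_of_mem hy,
            Finset.prod_eq_prod_Ico_succ_bot hjn, if_pos hjn.le,
            if_pos (Nat.succ_le_of_lt hjn)]
          simp only [Function.update_self, w]
          ring
        · rw [Set.indicator_of_notMem hy, Set.indicator_of_notMem hy, mul_zero]
      · refine (Measurable.indicator (Measurable.mul (Measurable.mul ?_ ?_) hGt) hE).comp hupd
        · exact Finset.measurable_prod _ fun k _ => (hw k).comp (measurable_pi_apply k)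
        · split_ifs
          · exact hz
          · exact measurable_const
    -- Here `j = n`: the integrand depends on this coordinate only through the event that it exceeds
    -- `u - arrival x j`, so only the exponential tail has to be corrected, and `z` is the ratio of
    -- the two tails.
    · have ha : ∀ y, arrival (Function.update x j y) j = arrival x j := fun y =>
        arrival_congr fun k hk => Function.update_of_ne hk.ne _ _
      have ht : ∀ y, truncated j u (Function.update x j y) = truncated j u x := fun y =>
        truncated_congr fun k hk => Function.update_of_ne hk.ne _ _
      have hmem : ∀ y, Function.update x j y ∈ E ↔ arrival x j ≤ u ∧ y ∈ Set.Ioi (u - arrival x j) := by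
        intro y
        simp only [E, Set.mem_ofPred_eq, arrival_succ, ha, Function.update_self, Set.mem_Ioi,
          sub_lt_iff_lt_add']
      by_cases hx : arrival x j ≤ u
      · have hind : ∀ (c : ℝ≥0∞) (f : (ℕ → ℝ) → ℝ≥0∞), (∀ y, f (Function.update x j y) = c) →
            ∀ y, E.indicator f (Function.update x j y)
              = (Set.Ioi (u - arrival x j)).indicator (fun _ => c) y := by
          intro c f hf y
          by_cases hy : y ∈ Set.Ioi (u - arrival x j)
          · rw [Set.indicator_of_mem ((hmem y).2 ⟨hx, hy⟩), Set.indicator_of_mem hy, hf]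
          · rw [Set.indicator_of_notMem (fun h => hy ((hmem y).1 h).2),
              Set.indicator_of_notMem hy]
        rw [lintegral_congr (hind (z x * G (truncated j u x)) _ fun y => by
            simp [z, ha, ht]),
          lintegral_congr (hind (G (truncated j u x)) _ fun y => by simp [ht])]
        rw [lintegral_indicator_const measurableSet_Ioi, lintegral_indicator_const measurableSet_Ioi,
          expMeasure_Ioi (hlam j) (sub_nonneg.2 hx), expMeasure_Ioi (hlam' j) (sub_nonneg.2 hx)]
        rw [mul_comm (z x), mul_assoc]
        congr 1
        simp only [z]
        rw [← ENNReal.ofReal_mul (Real.exp_pos _).le, ← Real.exp_add]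
        congr 2
        ring
      · have hno : ∀ y, Function.update x j y ∉ E := fun y h => hx ((hmem y).1 h).1
        simp [hno]
  · have h1 : x ∈ E ↔ x' ∈ E := by
      have h2 := arrival_congr h
      have h3 := arrival_congr (n := n) fun k hk => h k (by omega)
      simp only [E, Set.mem_ofPred_eq, h2, h3]
    have h4 := truncated_congr (n := n) (u := u) fun k hk => h k (by omega)
    by_cases hx : x ∈ E
    · rw [Set.indicator_of_mem hx, Set.indicator_of_mem (h1.1 hx)]
      simp [h4]
    · rw [Set.indicator_of_notMem hx, Set.indicator_of_notMem (fun h => hx (h1.2 h))]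

/-- Regular shocks are split by their number up to time `u`. -/
theorem RegularShocks.tsum_indicator {e : ℕ → ℝ} (he : RegularShocks e) {u : ℝ} (hu : 0 ≤ u)
    (f : ℕ → (ℕ → ℝ) → ℝ≥0∞) :
    ∑' n, {e | arrival e n ≤ u ∧ u < arrival e (n + 1)}.indicator (f n) e
      = f (shockCount e u).toNat e := by
  obtain ⟨n, h1, h2, hn⟩ := he.exists_count hu
  rw [tsum_eq_single n, Set.indicator_of_mem (Set.mem_ofPred_eq ▸ ⟨h1, h2⟩), hn, ENat.toNat_natCast]
  intro m hm
  refine Set.indicator_of_notMem (fun h => hm ?_) _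
  have := shockCount_eq_coe (fun k => (he.pos k).le) h.1 h.2
  rw [hn] at this
  exact_mod_cast this.symm

/-- The density at time `u` for the change of the shock intensities. -/
theorem lintegral_shockLaw_density {lam r : ℕ → ℝ} (hlam : ∀ n, 0 < lam n) (hr : ∀ n, -1 < r n)
    (hs : ¬ Summable fun n => (lam n)⁻¹) (hs' : ¬ Summable fun n => (lam n * (1 + r n))⁻¹)
    {u : ℝ} (hu : 0 ≤ u) {G : (ℕ → ℝ) → ℝ≥0∞} (hG : Measurable G) :
    ∫⁻ e, ENNReal.ofReal (Real.exp (-shockIntegral (fun n => lam n * r n) e u)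
        * ∏ k ∈ Finset.range (shockCount e u).toNat, (1 + r k)) * G (observed u e) ∂shockLaw lam
      = ∫⁻ e, G (observed u e) ∂shockLaw fun n => lam n * (1 + r n) := by
  have hlam' : ∀ n, 0 < lam n * (1 + r n) := fun n => mul_pos (hlam n) (by linarith [hr n])
  have hr1 : ∀ n, 0 < 1 + r n := fun n => by linarith [hr n]
  have hGt : ∀ n, Measurable fun e => G (truncated n u e) := fun n =>
    hG.comp (measurable_truncated n u)
  have hL := lintegral_tsum (μ := shockLaw lam) (f := fun n e =>
    {e | arrival e n ≤ u ∧ u < arrival e (n + 1)}.indicator (fun e =>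
        (∏ k ∈ Finset.range n, ENNReal.ofReal ((1 + r k) * Real.exp (-(lam k * r k * e k))))
          * ENNReal.ofReal (Real.exp (-(lam n * r n * (u - arrival e n))))
          * G (truncated n u e)) e) (fun n => by
      have := measurable_arrival n
      refine (Measurable.indicator (Measurable.mul ?_ (hGt n))
        (measurableSet_arrival n u)).aemeasurable
      fun_prop)
  have hR := lintegral_tsum (μ := shockLaw fun n => lam n * (1 + r n)) (f := fun n e =>
    {e | arrival e n ≤ u ∧ u < arrival e (n + 1)}.indicator
        (fun e => G (truncated n u e)) e) (fun n =>
      ((hGt n).indicator (measurableSet_arrival n u)).aemeasurable)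
  -- The identity holds for each number `n` of shocks. Regularity, almost sure under both laws, then
  -- leaves a single nonzero term in each sum.
  rw [tsum_congr fun n => lintegral_shockLaw_exchange hlam hr u n hG, ← hR] at hL
  refine Eq.trans (lintegral_congr_ae ?_) (hL.trans (lintegral_congr_ae ?_))
  · filter_upwards [ae_regularShocks hlam hs] with e he
    rw [he.tsum_indicator hu (fun n e => (∏ k ∈ Finset.range n,
          ENNReal.ofReal ((1 + r k) * Real.exp (-(lam k * r k * e k))))
          * ENNReal.ofReal (Real.exp (-(lam n * r n * (u - arrival e n))))
          * G (truncated n u e))]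
    obtain ⟨n, h1, h2, hn⟩ := he.exists_count hu
    rw [observed_eq_truncated hn, hn, ENat.toNat_natCast]
    congr 1
    rw [← ENNReal.ofReal_prod_of_nonneg fun k _ => (mul_pos (hr1 k) (Real.exp_pos _)).le,
      ← ENNReal.ofReal_mul (Finset.prod_nonneg fun k _ => (mul_pos (hr1 k) (Real.exp_pos _)).le)]
    congr 1
    rw [he.shockIntegral_eq _ h1 h2.le, neg_add, Real.exp_add, Finset.prod_mul_distrib,
      ← Finset.sum_neg_distrib, Real.exp_sum]
    ring
  · filter_upwards [ae_regularShocks hlam' hs'] with e he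
    rw [he.tsum_indicator hu (fun n e => G (truncated n u e))]
    obtain ⟨n, -, -, hn⟩ := he.exists_count hu
    rw [observed_eq_truncated hn, hn, ENat.toNat_natCast]

end ShockLaw

/-! ### The joint law of the shocks and the length of one holding period. -/

section PeriodLaw

/-- The joint law of the shocks and of the length of a holding period, described by the
conditional survivor function of the length given the shocks. -/
def IsPeriodLaw (ν : Measure ((ℕ → ℝ) × ℝ≥0∞)) (lam mu : ℕ → ℝ) : Prop :=
  ∀ (u : ℝ≥0) (B : Set (ℕ → ℝ)), MeasurableSet B →
    ν (B ×ˢ Set.Ioi (u : ℝ≥0∞))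
      = ∫⁻ e in B, ENNReal.ofReal (Real.exp (-shockIntegral mu e u)) ∂shockLaw lam

variable {ν : Measure ((ℕ → ℝ) × ℝ≥0∞)} {lam mu : ℕ → ℝ}

theorem IsPeriodLaw.ae_pos [IsProbabilityMeasure ν] (hν : IsPeriodLaw ν lam mu)
    (hlam : ∀ n, 0 < lam n) : ∀ᵐ p ∂ν, 0 < p.2 := by
  have := fun n => isProbabilityMeasure_expMeasure (hlam n)
  have h := hν 0 Set.univ MeasurableSet.univ
  simp only [NNReal.coe_zero, shockIntegral_zero, ENNReal.coe_zero, neg_zero, Real.exp_zero,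
    ENNReal.ofReal_one, lintegral_const, Measure.restrict_univ, measure_univ, mul_one] at h
  have hset : (Set.univ : Set (ℕ → ℝ)) ×ˢ Set.Ioi (0 : ℝ≥0∞) = {p | 0 < p.2} := by
    ext p; simp
  rw [hset] at h
  exact (mem_ae_iff_prob_eq_one (measurableSet_lt measurable_const measurable_snd)).2 h

theorem IsPeriodLaw.apply_prod_univ [IsProbabilityMeasure ν] (hν : IsPeriodLaw ν lam mu)
    (hlam : ∀ n, 0 < lam n) {B : Set (ℕ → ℝ)} (hB : MeasurableSet B) :
    ν (B ×ˢ Set.univ) = shockLaw lam B := by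
  have h := hν 0 B hB
  simp only [NNReal.coe_zero, shockIntegral_zero, ENNReal.coe_zero, neg_zero, Real.exp_zero,
    ENNReal.ofReal_one, lintegral_const, MeasurableSet.univ, Measure.restrict_apply,
    Set.univ_inter, one_mul] at h
  rw [← h]
  refine measure_congr ?_
  filter_upwards [hν.ae_pos hlam] with p hp
  exact propext ⟨fun h => ⟨h.1, hp⟩, fun h => ⟨h.1, trivial⟩⟩

theorem IsPeriodLaw.map_fst [IsProbabilityMeasure ν] (hν : IsPeriodLaw ν lam mu)
    (hlam : ∀ n, 0 < lam n) : ν.map Prod.fst = shockLaw lam := by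
  ext B hB
  rw [Measure.map_apply measurable_fst hB, ← hν.apply_prod_univ hlam hB, Set.prod_univ]

theorem IsPeriodLaw.ae_regularShocks [IsProbabilityMeasure ν] (hν : IsPeriodLaw ν lam mu)
    (hlam : ∀ n, 0 < lam n) (hs : ¬ Summable fun n => (lam n)⁻¹) :
    ∀ᵐ p ∂ν, RegularShocks p.1 := by
  have h := _root_.ae_regularShocks hlam hs
  rw [← hν.map_fst hlam] at h
  exact ae_of_ae_map measurable_fst.aemeasurable h

theorem IsPeriodLaw.lintegral_survival (hν : IsPeriodLaw ν lam mu) (u : ℝ≥0)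
    {f : (ℕ → ℝ) → ℝ≥0∞} (hf : Measurable f) :
    ∫⁻ p, {p | (u : ℝ≥0∞) < p.2}.indicator (fun p => f p.1) p ∂ν
      = ∫⁻ e, ENNReal.ofReal (Real.exp (-shockIntegral mu e u)) * f e ∂shockLaw lam := by
  have hmeas : MeasurableSet {p : (ℕ → ℝ) × ℝ≥0∞ | (u : ℝ≥0∞) < p.2} :=
    measurableSet_lt measurable_const measurable_snd
  have hd : Measurable fun e : ℕ → ℝ => ENNReal.ofReal (Real.exp (-shockIntegral mu e u)) := by
    fun_prop
  have key : (ν.restrict {p | (u : ℝ≥0∞) < p.2}).map Prod.fst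
      = (shockLaw lam).withDensity
        fun e => ENNReal.ofReal (Real.exp (-shockIntegral mu e u)) := by
    ext B hB
    rw [Measure.map_apply measurable_fst hB, Measure.restrict_apply (measurable_fst hB),
      withDensity_apply _ hB, ← hν u B hB]
    rfl
  rw [lintegral_indicator hmeas]
  calc _ = ∫⁻ e, f e ∂(ν.restrict {p | (u : ℝ≥0∞) < p.2}).map Prod.fst :=
        (lintegral_map hf measurable_fst).symm
    _ = _ := by
      rw [key, lintegral_withDensity_eq_lintegral_mul _ hd hf]
      rfl

theorem RegularShocks.lintegral_density {e : ℕ → ℝ} (he : RegularShocks e) (hmu : ∀ n, 0 < mu n)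
    {u : ℝ} (hu : 0 ≤ u) :
    ∫⁻ s in Set.Ioc 0 u, ENNReal.ofReal (mu (shockCount e s).toNat
        * Real.exp (-shockIntegral mu e s))
      = ENNReal.ofReal (1 - Real.exp (-shockIntegral mu e u)) := by
  have hcont : Continuous fun s => Real.exp (-shockIntegral mu e s) :=
    Real.continuous_exp.comp (he.continuous_shockIntegral mu).neg
  have hint := (he.intervalIntegrable mu 0 u).mul_continuousOn hcont.continuousOn
  rw [← he.integral_density mu hu, intervalIntegral.integral_of_le hu,
    ofReal_integral_eq_lintegral_ofReal ((intervalIntegrable_iff_integrableOn_Ioc_of_le hu).1 hint)]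
  exact Filter.Eventually.of_forall fun s => (mul_pos (hmu _) (Real.exp_pos _)).le

/-- Given the shocks, the finite part of the length has density `mu_N exp(-∫ mu)`, obtained by
differentiating the conditional survivor function. The remaining conditional mass sits at `⊤` and is
excluded by the indicator. -/
theorem IsPeriodLaw.lintegral_density [IsProbabilityMeasure ν] (hν : IsPeriodLaw ν lam mu)
    (hlam : ∀ n, 0 < lam n) (hs : ¬ Summable fun n => (lam n)⁻¹) (hmu : ∀ n, 0 < mu n)
    {f : (ℕ → ℝ) × ℝ → ℝ≥0∞} (hf : Measurable f) :
    ∫⁻ p, {p | p.2 ≠ ⊤}.indicator (fun p => f (p.1, p.2.toReal)) p ∂ν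
      = ∫⁻ e, (∫⁻ s in Set.Ioi (0 : ℝ), ENNReal.ofReal (mu (shockCount e s).toNat
        * Real.exp (-shockIntegral mu e s)) * f (e, s) ∂volume) ∂shockLaw lam := by
  have := fun n => isProbabilityMeasure_expMeasure (hlam n)
  have hfin : MeasurableSet {p : (ℕ → ℝ) × ℝ≥0∞ | p.2 ≠ ⊤} :=
    (measurable_snd (measurableSet_singleton ⊤)).compl
  have hd : Measurable fun q : (ℕ → ℝ) × ℝ => ENNReal.ofReal (mu (shockCount q.1 q.2).toNat
        * Real.exp (-shockIntegral mu q.1 q.2)) := by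
    have := measurable_rate mu
    fun_prop
  have hmap : Measurable fun p : (ℕ → ℝ) × ℝ≥0∞ => (p.1, p.2.toReal) := by fun_prop
  have key : (ν.restrict {p | p.2 ≠ ⊤}).map (fun p => (p.1, p.2.toReal))
      = ((shockLaw lam).prod (volume.restrict (Set.Ioi (0 : ℝ)))).withDensity
        fun q => ENNReal.ofReal (mu (shockCount q.1 q.2).toNat
        * Real.exp (-shockIntegral mu q.1 q.2)) := by
    refine Measure.ext_prod fun {S t} hS ht => ?_
    -- For fixed `S` both sides become measures on the line in `t`, so half-lines suffice to
    -- identify them.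
    have hslice : ∀ (m : Measure ((ℕ → ℝ) × ℝ)) {t : Set ℝ}, MeasurableSet t →
        (m.restrict (S ×ˢ Set.univ)).map Prod.snd t = m (S ×ˢ t) := by
      intro m t ht
      rw [Measure.map_apply measurable_snd ht, Measure.restrict_apply (measurable_snd ht)]
      congr 1
      ext p
      simp [and_comm]
    rw [← hslice _ ht, ← hslice _ ht]
    refine congrArg (fun m : Measure ℝ => m t) (Measure.ext_of_Iic _ _ fun a => ?_)
    rw [hslice _ measurableSet_Iic, hslice _ measurableSet_Iic,
      Measure.map_apply hmap (hS.prod measurableSet_Iic),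
      Measure.restrict_apply (hmap (hS.prod measurableSet_Iic)),
      withDensity_apply _ (hS.prod measurableSet_Iic), ← Measure.prod_restrict,
      lintegral_prod _ hd.aemeasurable, Measure.restrict_restrict measurableSet_Iic,
      Set.inter_comm, Set.Iic_inter_Ioi]
    rcases lt_or_ge a 0 with ha | ha
    · have h1 : {p : (ℕ → ℝ) × ℝ≥0∞ | p.2 ≠ ⊤}
          ∩ (fun p => (p.1, p.2.toReal)) ⁻¹' S ×ˢ Set.Iic a = ∅ := by
        ext p
        simp only [Set.mem_inter_iff, Set.mem_preimage, Set.mem_prod, Set.mem_Iic,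
          Set.mem_empty_iff_false, iff_false]
        rintro ⟨-, -, h⟩
        linarith [ENNReal.toReal_nonneg (a := p.2)]
      rw [h1, Set.Ioc_eq_empty (by linarith)]
      simp
    · lift a to ℝ≥0 using ha
      have h1 : {p : (ℕ → ℝ) × ℝ≥0∞ | p.2 ≠ ⊤}
          ∩ (fun p => (p.1, p.2.toReal)) ⁻¹' S ×ˢ Set.Iic (a : ℝ)
          = S ×ˢ Set.Iic (a : ℝ≥0∞) := by
        ext p
        simp only [Set.mem_inter_iff, Set.mem_preimage, Set.mem_prod, Set.mem_Iic,
          Set.mem_ofPred_eq]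
        constructor
        · rintro ⟨h, h2, h3⟩
          refine ⟨h2, (ENNReal.toReal_le_toReal h ENNReal.coe_ne_top).1 ?_⟩
          simpa using h3
        · rintro ⟨h2, h3⟩
          have h := ne_top_of_le_ne_top ENNReal.coe_ne_top h3
          refine ⟨h, h2, ?_⟩
          simpa using (ENNReal.toReal_le_toReal h ENNReal.coe_ne_top).2 h3
      have h2 : ν (S ×ˢ Set.Iic (a : ℝ≥0∞))
          + ν (S ×ˢ Set.Ioi (a : ℝ≥0∞)) = shockLaw lam S := by
        rw [← measure_union, ← Set.prod_union, Set.Iic_union_Ioi, hν.apply_prod_univ hlam hS]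
        · exact Set.disjoint_left.2 fun p h h' => not_lt.2 (Set.mem_Iic.1 h.2) h'.2
        · exact hS.prod measurableSet_Ioi
      have h3 : ∫⁻ e in S, (∫⁻ s in Set.Ioc (0 : ℝ) a,
            ENNReal.ofReal (mu (shockCount e s).toNat
              * Real.exp (-shockIntegral mu e s)) ∂volume) ∂shockLaw lam
          = ∫⁻ e in S, ENNReal.ofReal (1 - Real.exp (-shockIntegral mu e a)) ∂shockLaw lam := by
        refine lintegral_congr_ae (ae_restrict_of_ae ?_)
        filter_upwards [_root_.ae_regularShocks hlam hs] with e he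
        exact he.lintegral_density hmu a.coe_nonneg
      have h4 : ∫⁻ e in S, ENNReal.ofReal (1 - Real.exp (-shockIntegral mu e a)) ∂shockLaw lam
          + ν (S ×ˢ Set.Ioi (a : ℝ≥0∞)) = shockLaw lam S := by
        rw [hν _ _ hS, ← lintegral_add_left (by fun_prop), ← setLIntegral_one]
        refine lintegral_congr_ae (ae_restrict_of_ae ?_)
        filter_upwards [_root_.ae_regularShocks hlam hs] with e he
        have h5 := he.shockIntegral_mono (fun n => (hmu n).le) a.coe_nonneg
        rw [shockIntegral_zero] at h5
        have h6 : Real.exp (-shockIntegral mu e a) ≤ 1 := Real.exp_le_one_iff.2 (by linarith)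
        change ENNReal.ofReal _ + ENNReal.ofReal (Real.exp (-shockIntegral mu e a)) = 1
        rw [← ENNReal.ofReal_add (by linarith) (Real.exp_pos _).le]
        simp
      -- By `h2` and `h4`, adding the mass of `S ×ˢ Set.Ioi a` turns either side into `shockLaw lam
      -- S`; being finite, that mass cancels.
      rw [h1, h3]
      exact (ENNReal.add_left_inj (measure_ne_top _ _)).1 (h2.trans h4.symm)
  rw [lintegral_indicator hfin]
  calc _ = ∫⁻ q, f q ∂(ν.restrict {p | p.2 ≠ ⊤}).map (fun p => (p.1, p.2.toReal)) :=
        (lintegral_map hf hmap).symm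
    _ = _ := by
      rw [key, lintegral_withDensity_eq_lintegral_mul _ hd hf,
        lintegral_prod _ (hd.mul hf).aemeasurable]
      rfl

/-- The length is the first time at which the accumulated intensity reaches an independent `Exp(1)`
threshold; it is `⊤`, an empty infimum, if the threshold is never reached. It exceeds `u` exactly
when the intensity accumulated by `u` is below the threshold. -/
theorem exists_isPeriodLaw (hlam : ∀ n, 0 < lam n) (hs : ¬ Summable fun n => (lam n)⁻¹)
    (hmu : ∀ n, 0 < mu n) :
    ∃ ν : Measure ((ℕ → ℝ) × ℝ≥0∞), IsProbabilityMeasure ν ∧ IsPeriodLaw ν lam mu := by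
  classical
  have := fun n => isProbabilityMeasure_expMeasure (hlam n)
  have := isProbabilityMeasure_expMeasure (one_pos (α := ℝ))
  let L : (ℕ → ℝ) × ℝ → ℝ≥0∞ := fun q =>
    if RegularShocks q.1 then ⨅ (v : ℝ≥0) (_ : q.2 ≤ shockIntegral mu q.1 v), (v : ℝ≥0∞) else 0
  have hL : ∀ (u : ℝ≥0) q, (u : ℝ≥0∞) < L q
      ↔ RegularShocks q.1 ∧ shockIntegral mu q.1 u < q.2 := by
    intro u q
    by_cases hq : RegularShocks q.1
    · simp only [L, if_pos hq, hq, true_and]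
      constructor
      · intro h
        by_contra hle
        refine absurd h (not_lt.2 ?_)
        exact iInf₂_le (f := fun (v : ℝ≥0) (_ : q.2 ≤ shockIntegral mu q.1 v) => (v : ℝ≥0∞)) u
          (not_lt.1 hle)
      · intro h
        -- Continuity keeps the intensity below the threshold slightly beyond `u`; this is what
        -- makes the infimum strictly larger than `u`.
        have hev : ∀ᶠ s in nhdsWithin (u : ℝ) (Set.Ioi (u : ℝ)), shockIntegral mu q.1 s < q.2 :=
          ((hq.continuous_shockIntegral mu).tendsto (u : ℝ)).eventually_lt_const h
            |>.filter_mono nhdsWithin_le_nhds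
        obtain ⟨s, hs1, hs2⟩ := (hev.and self_mem_nhdsWithin).exists
        have hs0 : 0 ≤ s := u.2.trans (le_of_lt hs2)
        lift s to ℝ≥0 using hs0
        have h1 : (u : ℝ≥0∞) < (s : ℝ≥0∞) := by
          rw [ENNReal.coe_lt_coe]
          exact hs2
        refine lt_of_lt_of_le h1 (le_iInf₂ fun v hv => ?_)
        rw [ENNReal.coe_le_coe]
        by_contra hlt
        have h2 : (v : ℝ) ≤ s := le_of_lt (not_le.1 hlt)
        have := hq.shockIntegral_mono (fun n => (hmu n).le) h2
        linarith
    · simp [L, hq]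
  have hreg : MeasurableSet {q : (ℕ → ℝ) × ℝ | RegularShocks q.1} :=
    measurable_fst measurableSet_regularShocks
  have hset : ∀ u : ℝ≥0, MeasurableSet {q | (u : ℝ≥0∞) < L q} := by
    intro u
    have : {q | (u : ℝ≥0∞) < L q}
        = {q | RegularShocks q.1} ∩ {q | shockIntegral mu q.1 u < q.2} := by
      ext q
      exact hL u q
    rw [this]
    exact hreg.inter (measurableSet_lt (by fun_prop) measurable_snd)
  have hLm : Measurable L := by
    refine measurable_of_Ioi fun a => ?_
    induction a using ENNReal.recTopCoe with
    | top => simp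
    | coe u => exact hset u
  have hpair : Measurable fun q : (ℕ → ℝ) × ℝ => (q.1, L q) := measurable_fst.prodMk hLm
  refine ⟨((shockLaw lam).prod (expMeasure 1)).map fun q => (q.1, L q),
    Measure.isProbabilityMeasure_map hpair.aemeasurable, fun u B hB => ?_⟩
  have hpre : MeasurableSet ((fun q : (ℕ → ℝ) × ℝ => (q.1, L q)) ⁻¹'
      (B ×ˢ Set.Ioi (u : ℝ≥0∞))) := hpair (hB.prod measurableSet_Ioi)
  rw [Measure.map_apply hpair (hB.prod measurableSet_Ioi), Measure.prod_apply hpre,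
    ← lintegral_indicator hB]
  refine lintegral_congr_ae ?_
  filter_upwards [ae_regularShocks hlam hs] with e he
  by_cases heB : e ∈ B
  · rw [Set.indicator_of_mem heB]
    have h0 := he.shockIntegral_mono (fun n => (hmu n).le) u.coe_nonneg
    rw [shockIntegral_zero] at h0
    have h1 : Prod.mk e ⁻¹' ((fun q : (ℕ → ℝ) × ℝ => (q.1, L q)) ⁻¹'
        (B ×ˢ Set.Ioi (u : ℝ≥0∞))) = Set.Ioi (shockIntegral mu e u) := by
      ext y
      simp only [Set.mem_preimage, Set.mem_prod, Set.mem_Ioi]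
      rw [hL]
      exact ⟨fun h => h.2.2, fun h => ⟨heB, he, h⟩⟩
    rw [h1]
    exact (expMeasure_Ioi one_pos h0).trans (by rw [one_mul])
  · rw [Set.indicator_of_notMem heB]
    have h1 : Prod.mk e ⁻¹' ((fun q : (ℕ → ℝ) × ℝ => (q.1, L q)) ⁻¹'
        (B ×ˢ Set.Ioi (u : ℝ≥0∞))) = ∅ := by
      ext y
      simp [heB]
    rw [h1, measure_empty]

end PeriodLaw

/-! ### Change of both intensities within one holding period. -/

section PeriodExchange

/-- The density accumulated up to time `u` within a holding period. -/
def periodWeight (c r : ℕ → ℝ) (e : ℕ → ℝ) (u : ℝ) : ℝ :=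
  Real.exp (shockIntegral c e u) * ∏ k ∈ Finset.range (shockCount e u).toNat, (1 + r k)

theorem periodWeight_pos {c r : ℕ → ℝ} (hr : ∀ n, -1 < r n) (e : ℕ → ℝ) (u : ℝ) :
    0 < periodWeight c r e u :=
  mul_pos (Real.exp_pos _) (Finset.prod_pos fun k _ => by linarith [hr k])

@[fun_prop]
theorem Measurable.periodWeight {β : Type*} [MeasurableSpace β] {c r : ℕ → ℝ} {f : β → ℕ → ℝ}
    {g : β → ℝ} (hf : Measurable f) (hg : Measurable g) :
    Measurable fun x => periodWeight c r (f x) (g x) := by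
  unfold _root_.periodWeight
  have h1 : Measurable fun x => (_root_.shockCount (f x) (g x)).toNat := by fun_prop
  have h2 := measurable_prod_range h1 (g := fun k _ => 1 + r k) (fun k => measurable_const)
  exact (Real.measurable_exp.comp (by fun_prop)).mul h2

variable {lam mu r R : ℕ → ℝ}

/-- The tendency that compensates the jumps `r`, `R` at the intensities `lam`, `mu`. -/
def compensator (lam mu r R : ℕ → ℝ) (n : ℕ) : ℝ := -lam n * r n - mu n * R n

/-- The algebra behind the choice of the tendency: its part `-mu R` turns the survival factor for
`mu` into the one for `mu (1 + R)`, and its part `-lam r` is left for the change of the shock law.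
-/
theorem RegularShocks.periodWeight_mul_exp {e : ℕ → ℝ} (he : RegularShocks e) (u : ℝ) :
    periodWeight (compensator lam mu r R) r e u * Real.exp (-shockIntegral mu e u)
      = (Real.exp (-shockIntegral (fun n => lam n * r n) e u)
          * ∏ k ∈ Finset.range (shockCount e u).toNat, (1 + r k))
        * Real.exp (-shockIntegral (fun n => mu n * (1 + R n)) e u) := by
  have h1 : shockIntegral (compensator lam mu r R) e u
      = -shockIntegral (fun n => lam n * r n) e u + -shockIntegral (fun n => mu n * R n) e u := by
    rw [← shockIntegral_neg, ← shockIntegral_neg, ← he.shockIntegral_add]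
    congr 1
    funext n
    simp only [compensator]
    ring
  have h2 : shockIntegral (fun n => mu n * (1 + R n)) e u
      = shockIntegral mu e u + shockIntegral (fun n => mu n * R n) e u := by
    rw [← he.shockIntegral_add]
    congr 1
    funext n
    ring
  rw [periodWeight, h1, h2, neg_add, Real.exp_add, Real.exp_add]
  ring

/-- Change of the intensities for a holding period observed up to time `u` and not yet ended. -/
theorem lintegral_survival_exchange {ν ν' : Measure ((ℕ → ℝ) × ℝ≥0∞)}
    (hν : IsPeriodLaw ν lam mu)
    (hν' : IsPeriodLaw ν' (fun n => lam n * (1 + r n)) fun n => mu n * (1 + R n))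
    (hlam : ∀ n, 0 < lam n) (hr : ∀ n, -1 < r n)
    (hs : ¬ Summable fun n => (lam n)⁻¹) (hs' : ¬ Summable fun n => (lam n * (1 + r n))⁻¹)
    (u : ℝ≥0) {ψ : (ℕ → ℝ) → ℝ≥0∞} (hψ : Measurable ψ) :
    ∫⁻ p, {p | (u : ℝ≥0∞) < p.2}.indicator (fun p =>
        ENNReal.ofReal (periodWeight (compensator lam mu r R) r p.1 u) * ψ (observed u p.1)) p ∂ν
      = ∫⁻ p, {p | (u : ℝ≥0∞) < p.2}.indicator (fun p => ψ (observed u p.1)) p ∂ν' := by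
  have hlam' : ∀ n, 0 < lam n * (1 + r n) := fun n => mul_pos (hlam n) (by linarith [hr n])
  rw [hν.lintegral_survival u (f := fun e =>
      ENNReal.ofReal (periodWeight (compensator lam mu r R) r e u) * ψ (observed u e))
      (by fun_prop),
    hν'.lintegral_survival u (f := fun e => ψ (observed u e)) (by fun_prop)]
  -- The new survival factor may be put into the test function because it depends only on the shocks
  -- observed by `u`.
  have key := lintegral_shockLaw_density hlam hr hs hs' u.coe_nonneg (G := fun e =>
    ENNReal.ofReal (Real.exp (-shockIntegral (fun n => mu n * (1 + R n)) e u)) * ψ e) (by fun_prop)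
  refine Eq.trans (lintegral_congr_ae ?_) (key.trans (lintegral_congr_ae ?_))
  · filter_upwards [ae_regularShocks hlam hs] with e he
    rw [shockIntegral_observed (fun k => (he.pos k).le) u.coe_nonneg le_rfl, ← mul_assoc,
      ← mul_assoc, ← ENNReal.ofReal_mul (Real.exp_pos _).le,
      ← ENNReal.ofReal_mul' (Real.exp_pos _).le, ← he.periodWeight_mul_exp, mul_comm (Real.exp _)]
  · filter_upwards [ae_regularShocks hlam' hs'] with e he
    rw [shockIntegral_observed (fun k => (he.pos k).le) u.coe_nonneg le_rfl]

/-- Change of the intensities for a completed holding period. -/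
theorem lintegral_completed_exchange {ν ν' : Measure ((ℕ → ℝ) × ℝ≥0∞)}
    [IsProbabilityMeasure ν] [IsProbabilityMeasure ν']
    (hν : IsPeriodLaw ν lam mu)
    (hν' : IsPeriodLaw ν' (fun n => lam n * (1 + r n)) fun n => mu n * (1 + R n))
    (hlam : ∀ n, 0 < lam n) (hr : ∀ n, -1 < r n) (hmu : ∀ n, 0 < mu n) (hR : ∀ n, -1 < R n)
    (hs : ¬ Summable fun n => (lam n)⁻¹) (hs' : ¬ Summable fun n => (lam n * (1 + r n))⁻¹)
    {ψ : (ℕ → ℝ) × ℝ → ℝ≥0∞} (hψ : Measurable ψ) :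
    ∫⁻ p, {p | p.2 ≠ ⊤}.indicator (fun p =>
        ENNReal.ofReal (periodWeight (compensator lam mu r R) r p.1 p.2.toReal
          * (1 + R (shockCount p.1 p.2.toReal).toNat))
          * ψ (observed p.2.toReal p.1, p.2.toReal)) p ∂ν
      = ∫⁻ p, {p | p.2 ≠ ⊤}.indicator
        (fun p => ψ (observed p.2.toReal p.1, p.2.toReal)) p ∂ν' := by
  have hlam' : ∀ n, 0 < lam n * (1 + r n) := fun n => mul_pos (hlam n) (by linarith [hr n])
  have hmu' : ∀ n, 0 < mu n * (1 + R n) := fun n => mul_pos (hmu n) (by linarith [hR n])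
  have := fun n => isProbabilityMeasure_expMeasure (hlam n)
  have := fun n => isProbabilityMeasure_expMeasure (hlam' n)
  have hrate : ∀ a : ℕ → ℝ, Measurable fun q : (ℕ → ℝ) × ℝ => a (shockCount q.1 q.2).toNat :=
    measurable_rate
  have hf1 : Measurable fun q : (ℕ → ℝ) × ℝ =>
      ENNReal.ofReal (periodWeight (compensator lam mu r R) r q.1 q.2
        * (1 + R (shockCount q.1 q.2).toNat)) * ψ (observed q.2 q.1, q.2) := by
    have := hrate R
    fun_prop
  have hf2 : Measurable fun q : (ℕ → ℝ) × ℝ => ψ (observed q.2 q.1, q.2) := by fun_prop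
  have hd1 : Measurable fun q : (ℕ → ℝ) × ℝ => ENNReal.ofReal (mu (shockCount q.1 q.2).toNat
        * Real.exp (-shockIntegral mu q.1 q.2)) := by
    have := hrate mu
    fun_prop
  have hd2 : Measurable fun q : (ℕ → ℝ) × ℝ =>
      ENNReal.ofReal (mu (shockCount q.1 q.2).toNat * (1 + R (shockCount q.1 q.2).toNat)
        * Real.exp (-shockIntegral (fun n => mu n * (1 + R n)) q.1 q.2)) := by
    have := hrate fun n => mu n * (1 + R n)
    fun_prop
  rw [hν.lintegral_density hlam hs hmu hf1, hν'.lintegral_density hlam' hs' hmu' hf2]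
  -- Tonelli fixes the end `s` of the period first; the shocks are then exchanged at the
  -- deterministic time `s`.
  refine (lintegral_lintegral_swap (hd1.mul hf1).aemeasurable).trans
    (Eq.trans ?_ (lintegral_lintegral_swap (hd2.mul hf2).aemeasurable).symm)
  refine setLIntegral_congr_fun measurableSet_Ioi fun s hs0 => ?_
  have hs0' : (0 : ℝ) ≤ s := le_of_lt hs0
  have hpair : Measurable fun e : ℕ → ℝ => (e, s) := by fun_prop
  have key := lintegral_shockLaw_density hlam hr hs hs' hs0' (G := fun e =>
    ENNReal.ofReal (mu (shockCount e s).toNat * (1 + R (shockCount e s).toNat)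
        * Real.exp (-shockIntegral (fun n => mu n * (1 + R n)) e s)) * ψ (e, s))
      ((hd2.comp hpair).mul (hψ.comp hpair))
  refine Eq.trans (lintegral_congr_ae ?_) (key.trans (lintegral_congr_ae ?_))
  · filter_upwards [ae_regularShocks hlam hs] with e he
    have hR' : 0 ≤ 1 + R (shockCount e s).toNat := by linarith [hR (shockCount e s).toNat]
    have hw := periodWeight_pos (c := compensator lam mu r R) hr e s
    have hm := hmu (shockCount e s).toNat
    rw [shockIntegral_observed (fun k => (he.pos k).le) hs0' le_rfl,
      shockCount_observed (fun k => (he.pos k).le) hs0' le_rfl, ← mul_assoc,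
      ← mul_assoc, ← ENNReal.ofReal_mul (by positivity), ← ENNReal.ofReal_mul' (by positivity)]
    congr 2
    linear_combination (mu (shockCount e s).toNat * (1 + R (shockCount e s).toNat))
      * he.periodWeight_mul_exp (lam := lam) (mu := mu) (r := r) (R := R) s
  · filter_upwards [ae_regularShocks hlam' hs'] with e he
    rw [shockIntegral_observed (fun k => (he.pos k).le) hs0' le_rfl,
      shockCount_observed (fun k => (he.pos k).le) hs0' le_rfl]

end PeriodExchange

/-! ### Sequences of holding periods: exchange on the event that `t` lies in period `m`. -/

section Paths

/-- The end of the first `m` holding periods of a path, given by the shocks and the length of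
each period. -/
def pathTime (x : ℕ → (ℕ → ℝ) × ℝ≥0∞) (m : ℕ) : ℝ≥0∞ := ∑ k ∈ Finset.range m, (x k).2

/-- The paths which are in period `m` at time `t`. -/
def inPeriod (m : ℕ) (t : ℝ≥0) : Set (ℕ → (ℕ → ℝ) × ℝ≥0∞) :=
  {x | pathTime x m ≤ t ∧ (t : ℝ≥0∞) < pathTime x (m + 1)}

/-- The part of a path known at time `t`, on the event that `t` is in period `m`. -/
def observedPath (m : ℕ) (t : ℝ≥0) (x : ℕ → (ℕ → ℝ) × ℝ≥0∞) (k : ℕ) : (ℕ → ℝ) × ℝ≥0∞ :=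
  if k < m then (observed (x k).2.toReal (x k).1, (x k).2)
  else if k = m then (observed (t - (pathTime x m).toReal) (x m).1, ⊤)
  else (fun _ => 1, ⊤)

/-- The density contributed by a completed holding period. -/
def completedWeight (c r R : ℕ → ℝ) (p : (ℕ → ℝ) × ℝ≥0∞) : ℝ :=
  periodWeight c r p.1 p.2.toReal * (1 + R (shockCount p.1 p.2.toReal).toNat)

theorem completedWeight_pos {c r R : ℕ → ℝ} (hr : ∀ n, -1 < r n) (hR : ∀ n, -1 < R n)
    (p : (ℕ → ℝ) × ℝ≥0∞) : 0 < completedWeight c r R p :=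
  mul_pos (periodWeight_pos hr _ _) (by linarith [hR (shockCount p.1 p.2.toReal).toNat])

theorem measurable_completedWeight (c r R : ℕ → ℝ) : Measurable (completedWeight c r R) := by
  unfold completedWeight
  have h : Measurable fun p : (ℕ → ℝ) × ℝ≥0∞ => (shockCount p.1 p.2.toReal).toNat := by fun_prop
  have h2 : Measurable fun p : (ℕ → ℝ) × ℝ≥0∞ => R (shockCount p.1 p.2.toReal).toNat :=
    (measurable_of_countable R).comp h
  fun_prop

theorem measurable_pathTime (m : ℕ) : Measurable fun x => pathTime x m := by
  unfold pathTime
  fun_prop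

theorem measurableSet_inPeriod (m : ℕ) (t : ℝ≥0) : MeasurableSet (inPeriod m t) :=
  (measurableSet_le (measurable_pathTime m) measurable_const).inter
    (measurableSet_lt measurable_const (measurable_pathTime (m + 1)))

theorem measurable_observedPath (m : ℕ) (t : ℝ≥0) : Measurable (observedPath m t) := by
  refine measurable_pi_iff.2 fun k => ?_
  unfold observedPath
  have := measurable_pathTime m
  split_ifs
  · fun_prop
  · fun_prop
  · exact measurable_const

theorem pathTime_congr {x x' : ℕ → (ℕ → ℝ) × ℝ≥0∞} {m : ℕ} (h : ∀ k < m, (x k).2 = (x' k).2) :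
    pathTime x m = pathTime x' m :=
  Finset.sum_congr rfl fun k hk => h k (Finset.mem_range.1 hk)

theorem pathTime_succ (x : ℕ → (ℕ → ℝ) × ℝ≥0∞) (m : ℕ) :
    pathTime x (m + 1) = pathTime x m + (x m).2 :=
  Finset.sum_range_succ _ _

theorem pathTime_mono (x : ℕ → (ℕ → ℝ) × ℝ≥0∞) : Monotone (pathTime x) :=
  monotone_nat_of_le_succ fun n => by rw [pathTime_succ]; exact le_self_add

theorem inPeriod_congr {x x' : ℕ → (ℕ → ℝ) × ℝ≥0∞} {m : ℕ} {t : ℝ≥0}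
    (h : ∀ k < m + 1, (x k).2 = (x' k).2) : x ∈ inPeriod m t ↔ x' ∈ inPeriod m t := by
  simp only [inPeriod, Set.mem_ofPred_eq, pathTime_congr h,
    pathTime_congr fun k hk => h k (Nat.lt_succ_of_lt hk)]

theorem ne_top_of_mem_inPeriod {x : ℕ → (ℕ → ℝ) × ℝ≥0∞} {m : ℕ} {t : ℝ≥0} (h : x ∈ inPeriod m t)
    {k : ℕ} (hk : k < m) : (x k).2 ≠ ⊤ := by
  refine ne_top_of_le_ne_top ENNReal.coe_ne_top (le_trans ?_ h.1)
  exact Finset.single_le_sum (f := fun k => (x k).2) (fun _ _ => zero_le) (Finset.mem_range.2 hk)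

variable {lam mu r R : ℕ → ℕ → ℝ} {ν ν' : ℕ → Measure ((ℕ → ℝ) × ℝ≥0∞)}

/-- The density of a path at time `t` in period `m`, with the first `j` factors left out. -/
def tailWeight (c r R : ℕ → ℕ → ℝ) (m : ℕ) (t : ℝ≥0) (j : ℕ) (x : ℕ → (ℕ → ℝ) × ℝ≥0∞) : ℝ≥0∞ :=
  (∏ k ∈ Finset.Ico j m, ENNReal.ofReal (completedWeight (c k) (r k) (R k) (x k)))
    * if j ≤ m then
        ENNReal.ofReal (periodWeight (c m) (r m) (x m).1 (t - (pathTime x m).toReal)) else 1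

theorem measurable_tailWeight (c r R : ℕ → ℕ → ℝ) (m : ℕ) (t : ℝ≥0) (j : ℕ) :
    Measurable (tailWeight c r R m t j) := by
  unfold tailWeight
  have := measurable_pathTime m
  refine Measurable.mul (Finset.measurable_prod _ fun k _ => ?_) ?_
  · exact ((measurable_completedWeight _ _ _).comp (measurable_pi_apply k)).ennreal_ofReal
  · split_ifs
    · fun_prop
    · exact measurable_const

/-- Periods before `j` enter only through their lengths, which fix the age of the current period.
Their shocks can thus be altered freely. -/
theorem tailWeight_congr (c r R : ℕ → ℕ → ℝ) (m : ℕ) (t : ℝ≥0) (j : ℕ)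
    {x x' : ℕ → (ℕ → ℝ) × ℝ≥0∞} (h1 : ∀ k, j ≤ k → x k = x' k) (h2 : ∀ k, (x k).2 = (x' k).2) :
    tailWeight c r R m t j x = tailWeight c r R m t j x' := by
  unfold tailWeight
  congr 1
  · exact Finset.prod_congr rfl fun k hk => by rw [h1 k (Finset.mem_Ico.1 hk).1]
  · split_ifs with hj
    · rw [h1 m hj, pathTime_congr fun k _ => h2 k]
    · rfl

theorem tailWeight_of_lt (c r R : ℕ → ℕ → ℝ) {m : ℕ} (t : ℝ≥0) {j : ℕ} (hj : j < m)
    (x : ℕ → (ℕ → ℝ) × ℝ≥0∞) : tailWeight c r R m t j x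
      = ENNReal.ofReal (completedWeight (c j) (r j) (R j) (x j)) * tailWeight c r R m t (j + 1) x := by
  unfold tailWeight
  rw [Finset.prod_eq_prod_Ico_succ_bot hj, if_pos hj.le, if_pos (Nat.succ_le_of_lt hj), mul_assoc]

/-- Change of the intensities for paths in period `m` at time `t`. -/
theorem lintegral_inPeriod_exchange [∀ k, IsProbabilityMeasure (ν k)]
    [∀ k, IsProbabilityMeasure (ν' k)]
    (hν : ∀ k, IsPeriodLaw (ν k) (lam k) (mu k))
    (hν' : ∀ k, IsPeriodLaw (ν' k) (fun n => lam k n * (1 + r k n)) fun n => mu k n * (1 + R k n))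
    (hlam : ∀ k n, 0 < lam k n) (hr : ∀ k n, -1 < r k n) (hmu : ∀ k n, 0 < mu k n)
    (hR : ∀ k n, -1 < R k n) (hs : ∀ k, ¬ Summable fun n => (lam k n)⁻¹)
    (hs' : ∀ k, ¬ Summable fun n => (lam k n * (1 + r k n))⁻¹)
    (m : ℕ) (t : ℝ≥0) {F : (ℕ → (ℕ → ℝ) × ℝ≥0∞) → ℝ≥0∞} (hF : Measurable F) :
    ∫⁻ x, (inPeriod m t).indicator (fun x =>
        tailWeight (fun k => compensator (lam k) (mu k) (r k) (R k)) r R m t 0 x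
          * F (observedPath m t x)) x ∂Measure.infinitePi ν
      = ∫⁻ x, (inPeriod m t).indicator (fun x => F (observedPath m t x)) x
          ∂Measure.infinitePi ν' := by
  let c : ℕ → ℕ → ℝ := fun k => compensator (lam k) (mu k) (r k) (R k)
  have hW : ∀ j, Measurable (tailWeight c r R m t j) := measurable_tailWeight c r R m t
  have hD := measurable_observedPath m t
  have hE := measurableSet_inPeriod m t
  have key := lintegral_infinitePi_exchange ν ν' (m + 1)
    (fun j => (inPeriod m t).indicator fun x => tailWeight c r R m t j x * F (observedPath m t x))
    (fun j => ((hW j).mul (hF.comp hD)).indicator hE) (fun j hj x => ?_) (fun x x' h => ?_)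
  · simpa [tailWeight] using key
  · rcases Nat.lt_succ_iff_lt_or_eq.1 hj with hjm | rfl
    · -- a completed period
      -- All other periods are frozen. The event, the remaining weight and the other observed
      -- periods use only the length of period `j`, so its shocks are set to `0` there, and the
      -- observed shocks `q.1` are reinserted just in the argument of `F`.
      let ψ : (ℕ → ℝ) × ℝ → ℝ≥0∞ := fun q =>
        (inPeriod m t).indicator (fun x' => tailWeight c r R m t (j + 1) x'
          * F (Function.update (observedPath m t x') j (q.1, ENNReal.ofReal q.2)))
          (Function.update x j (0, ENNReal.ofReal q.2))
      have hu : Measurable fun q : (ℕ → ℝ) × ℝ =>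
          Function.update x j ((0 : ℕ → ℝ), ENNReal.ofReal q.2) :=
        (measurable_update x).comp (by fun_prop)
      have hψ : Measurable ψ := by
        have h1 : Measurable fun q : (ℕ → ℝ) × ℝ =>
            Function.update (observedPath m t (Function.update x j ((0 : ℕ → ℝ), ENNReal.ofReal q.2)))
              j (q.1, ENNReal.ofReal q.2) := by
          refine measurable_pi_iff.2 fun k => ?_
          by_cases hk : k = j
          · subst hk
            simp only [Function.update_self]
            fun_prop
          · simp only [Function.update_of_ne hk]
            exact (measurable_pi_apply k).comp (hD.comp hu)
        exact ((((hW (j + 1)).comp hu).mul (hF.comp h1)).indicator (hu hE))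
      have hval : ∀ y : (ℕ → ℝ) × ℝ≥0∞,
          (inPeriod m t).indicator (fun x => tailWeight c r R m t (j + 1) x
            * F (observedPath m t x)) (Function.update x j y)
          = {p : (ℕ → ℝ) × ℝ≥0∞ | p.2 ≠ ⊤}.indicator
            (fun p => ψ (observed p.2.toReal p.1, p.2.toReal)) y := by
        intro y
        by_cases hy : y.2 = ⊤
        · rw [Set.indicator_of_notMem (show y ∉ {p : (ℕ → ℝ) × ℝ≥0∞ | p.2 ≠ ⊤} from fun h => h hy)]
          refine Set.indicator_of_notMem (fun h => ?_) _
          exact ne_top_of_mem_inPeriod h hjm (by simpa using hy)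
        · rw [Set.indicator_of_mem (show y ∈ {p : (ℕ → ℝ) × ℝ≥0∞ | p.2 ≠ ⊤} from hy)]
          simp only [ψ, ENNReal.ofReal_toReal hy]
          have h2 : ∀ k, (Function.update x j y k).2
              = (Function.update x j ((0 : ℕ → ℝ), y.2) k).2 := by
            intro k
            by_cases hk : k = j
            · subst hk; simp
            · simp [Function.update_of_ne hk]
          have h3 : ∀ k, k ≠ j → Function.update x j y k
              = Function.update x j ((0 : ℕ → ℝ), y.2) k := by
            intro k hk
            simp [Function.update_of_ne hk]
          have hmem := inPeriod_congr (m := m) (t := t) fun k _ => h2 k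
          have hobs : observedPath m t (Function.update x j y)
              = Function.update (observedPath m t (Function.update x j ((0 : ℕ → ℝ), y.2))) j
                (observed y.2.toReal y.1, y.2) := by
            funext k
            by_cases hk : k = j
            · subst hk
              simp [observedPath, hjm]
            · rw [Function.update_of_ne hk]
              simp only [observedPath, h3 k hk, h3 m hjm.ne', pathTime_congr fun k _ => h2 k]
          by_cases hin : Function.update x j y ∈ inPeriod m t
          · rw [Set.indicator_of_mem hin, Set.indicator_of_mem (hmem.1 hin), hobs,
              tailWeight_congr c r R m t (j + 1) (fun k hk => h3 k (by omega)) h2]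
          · rw [Set.indicator_of_notMem hin, Set.indicator_of_notMem (fun h => hin (hmem.2 h))]
      have := lintegral_completed_exchange (hν j) (hν' j) (hlam j) (hr j) (hmu j) (hR j) (hs j)
        (hs' j) hψ
      rw [lintegral_congr hval, ← this]
      refine lintegral_congr fun y => ?_
      have hsplit : (inPeriod m t).indicator (fun x => tailWeight c r R m t j x
            * F (observedPath m t x)) (Function.update x j y)
          = ENNReal.ofReal (completedWeight (c j) (r j) (R j) y)
            * (inPeriod m t).indicator (fun x => tailWeight c r R m t (j + 1) x
            * F (observedPath m t x)) (Function.update x j y) := by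
        by_cases hin : Function.update x j y ∈ inPeriod m t
        · rw [Set.indicator_of_mem hin, Set.indicator_of_mem hin, tailWeight_of_lt c r R t hjm,
            Function.update_self, mul_assoc]
        · rw [Set.indicator_of_notMem hin, Set.indicator_of_notMem hin, mul_zero]
      rw [hsplit, hval]
      by_cases hy : y ∈ {p : (ℕ → ℝ) × ℝ≥0∞ | p.2 ≠ ⊤}
      · rw [Set.indicator_of_mem hy, Set.indicator_of_mem hy]
        rfl
      · rw [Set.indicator_of_notMem hy, Set.indicator_of_notMem hy, mul_zero]
    · -- the current period
      have hpt : ∀ y, pathTime (Function.update x j y) j = pathTime x j := fun y =>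
        pathTime_congr fun k hk => by rw [Function.update_of_ne hk.ne]
      by_cases hx : pathTime x j ≤ t
      · have hne : pathTime x j ≠ ⊤ := ne_top_of_le_ne_top ENNReal.coe_ne_top hx
        have hle : (pathTime x j).toNNReal ≤ t := by
          rw [← ENNReal.coe_le_coe, ENNReal.coe_toNNReal hne]
          exact hx
        -- The age of period `j` at time `t`. Given the earlier periods, being in period `j` means
        -- that its length exceeds `u`.
        let u : ℝ≥0 := t - (pathTime x j).toNNReal
        have hu : (u : ℝ) = t - (pathTime x j).toReal := by
          simp only [u]
          rw [NNReal.coe_sub hle]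
          rfl
        have hmem : ∀ y, Function.update x j y ∈ inPeriod j t ↔ (u : ℝ≥0∞) < y.2 := by
          intro y
          simp only [inPeriod, Set.mem_ofPred_eq, pathTime_succ, hpt, Function.update_self, hx,
            true_and, u, ENNReal.coe_sub, ENNReal.coe_toNNReal hne]
          rw [ENNReal.sub_lt_iff_lt_left hne hx]
        let ψ : (ℕ → ℝ) → ℝ≥0∞ := fun e => F (Function.update (observedPath j t x) j (e, ⊤))
        have hψ : Measurable ψ := hF.comp ((measurable_update _).comp (by fun_prop))
        have hobs : ∀ y, F (observedPath j t (Function.update x j y)) = ψ (observed u y.1) := by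
          intro y
          simp only [ψ]
          congr 1
          funext k
          by_cases hk : k = j
          · subst hk
            simp [observedPath, hpt, hu]
          · rw [Function.update_of_ne hk]
            simp only [observedPath, Function.update_of_ne hk, hk, if_false]
        have hind : ∀ (f : (ℕ → (ℕ → ℝ) × ℝ≥0∞) → ℝ≥0∞) (g : (ℕ → ℝ) × ℝ≥0∞ → ℝ≥0∞),
            (∀ y, f (Function.update x j y) = g y) → ∀ y,
            (inPeriod j t).indicator f (Function.update x j y)
              = {p : (ℕ → ℝ) × ℝ≥0∞ | (u : ℝ≥0∞) < p.2}.indicator g y := by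
          intro f g hfg y
          by_cases hy : y ∈ {p : (ℕ → ℝ) × ℝ≥0∞ | (u : ℝ≥0∞) < p.2}
          · rw [Set.indicator_of_mem hy, Set.indicator_of_mem ((hmem y).2 hy), hfg]
          · rw [Set.indicator_of_notMem hy,
              Set.indicator_of_notMem (fun h => hy ((hmem y).1 h))]
        rw [lintegral_congr (hind _ (fun p =>
            ENNReal.ofReal (periodWeight (c j) (r j) p.1 u) * ψ (observed u p.1)) fun y => by
            simp [tailWeight, hobs, hpt, hu]),
          lintegral_congr (hind _ (fun p => ψ (observed u p.1)) fun y => by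
            simp [tailWeight, hobs])]
        exact lintegral_survival_exchange (hν j) (hν' j) (hlam j) (hr j) (hs j) (hs' j) u hψ
      · have hno : ∀ y, Function.update x j y ∉ inPeriod j t := fun y h => hx (by
          have := h.1
          rwa [hpt] at this)
        simp [hno]
  · have hmem : x ∈ inPeriod m t ↔ x' ∈ inPeriod m t := inPeriod_congr fun k hk => by rw [h k hk]
    have hobs : observedPath m t x = observedPath m t x' := by
      funext k
      have hp : pathTime x m = pathTime x' m := pathTime_congr fun k hk => by rw [h k (by omega)]
      unfold observedPath
      split_ifs with h1 h2
      · rw [h k (by omega)]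
      · rw [h m (by omega), hp]
      · rfl
    by_cases hx : x ∈ inPeriod m t
    · rw [Set.indicator_of_mem hx, Set.indicator_of_mem (hmem.1 hx)]
      simp [tailWeight, hobs]
    · rw [Set.indicator_of_notMem hx, Set.indicator_of_notMem (fun h => hx (hmem.2 h))]

end Paths

/-! ### Switchings do not accumulate. -/

section RegularPaths

/-- Paths with regular shocks whose switchings do not accumulate. -/
structure RegularPath (x : ℕ → (ℕ → ℝ) × ℝ≥0∞) : Prop where
  shocks : ∀ k, RegularShocks (x k).1
  unbounded : ∀ t : ℝ≥0, ∃ m, (t : ℝ≥0∞) < pathTime x m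

theorem RegularPath.exists_inPeriod {x : ℕ → (ℕ → ℝ) × ℝ≥0∞} (hx : RegularPath x) (t : ℝ≥0) :
    ∃ m, x ∈ inPeriod m t := by
  classical
  have hex := hx.unbounded t
  have hpos : 0 < Nat.find hex := by
    rw [Nat.find_pos]
    simp [pathTime]
  obtain ⟨n, hn⟩ := Nat.exists_eq_succ_of_ne_zero hpos.ne'
  refine ⟨n, not_lt.1 (Nat.find_min hex (by omega)), ?_⟩
  have := Nat.find_spec hex
  rwa [hn] at this

/-- `exp (-T)` for the length `T` of a holding period. -/
def expNegLength (p : (ℕ → ℝ) × ℝ≥0∞) : ℝ≥0∞ :=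
  {p : (ℕ → ℝ) × ℝ≥0∞ | p.2 ≠ ⊤}.indicator
    (fun p => ENNReal.ofReal (Real.exp (-p.2.toReal))) p

theorem measurable_expNegLength : Measurable expNegLength :=
  Measurable.indicator (by fun_prop) (measurable_snd (measurableSet_singleton ⊤)).compl

theorem IsPeriodLaw.lintegral_expNegLength_lt_one {ν : Measure ((ℕ → ℝ) × ℝ≥0∞)}
    [IsProbabilityMeasure ν] {lam mu : ℕ → ℝ} (hν : IsPeriodLaw ν lam mu)
    (hlam : ∀ n, 0 < lam n) : ∫⁻ p, expNegLength p ∂ν < 1 := by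
  have hle : ∀ p, expNegLength p ≤ 1 := by
    intro p
    refine Set.indicator_apply_le' (fun _ => ?_) (fun _ => zero_le_one)
    rw [ENNReal.ofReal_le_one, Real.exp_le_one_iff]
    linarith [ENNReal.toReal_nonneg (a := p.2)]
  have h1 : ∫⁻ _, (1 : ℝ≥0∞) ∂ν = 1 := by simp
  have h2 : ∫⁻ p, expNegLength p ∂ν ≠ ⊤ :=
    ne_top_of_le_ne_top ENNReal.one_ne_top ((lintegral_mono hle).trans h1.le)
  rw [← h1]
  refine lintegral_strict_mono (IsProbabilityMeasure.ne_zero ν) aemeasurable_const h2 ?_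
  filter_upwards [hν.ae_pos hlam] with p hp
  by_cases hp2 : p.2 = ⊤
  · simp [expNegLength, hp2]
  · rw [expNegLength, Set.indicator_of_mem (show p ∈ {p : (ℕ → ℝ) × ℝ≥0∞ | p.2 ≠ ⊤} from hp2),
      ENNReal.ofReal_lt_one, Real.exp_lt_one_iff]
    linarith [ENNReal.toReal_pos hp.ne' hp2]

/-- The mean is determined by the intensities alone. With finitely many patterns, infinitely many
periods thus have only finitely many means. -/
theorem IsPeriodLaw.lintegral_expNegLength_eq {ν ν' : Measure ((ℕ → ℝ) × ℝ≥0∞)}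
    [IsProbabilityMeasure ν] [IsProbabilityMeasure ν'] {lam mu : ℕ → ℝ}
    (hν : IsPeriodLaw ν lam mu) (hν' : IsPeriodLaw ν' lam mu)
    (hlam : ∀ n, 0 < lam n) (hs : ¬ Summable fun n => (lam n)⁻¹) (hmu : ∀ n, 0 < mu n) :
    ∫⁻ p, expNegLength p ∂ν = ∫⁻ p, expNegLength p ∂ν' := by
  have hf : Measurable fun q : (ℕ → ℝ) × ℝ => ENNReal.ofReal (Real.exp (-q.2)) := by fun_prop
  exact (hν.lintegral_density hlam hs hmu hf).trans (hν'.lintegral_density hlam hs hmu hf).symm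

/-- Periods following finitely many pairs of intensity sequences do not accumulate. -/
theorem ae_regularPath {ι : Type*} [Finite ι] {lam mu : ι → ℕ → ℝ} (σ : ℕ → ι)
    {ν : ℕ → Measure ((ℕ → ℝ) × ℝ≥0∞)} [∀ k, IsProbabilityMeasure (ν k)]
    (hν : ∀ k, IsPeriodLaw (ν k) (lam (σ k)) (mu (σ k)))
    (hlam : ∀ i n, 0 < lam i n) (hs : ∀ i, ¬ Summable fun n => (lam i n)⁻¹)
    (hmu : ∀ i n, 0 < mu i n) : ∀ᵐ x ∂Measure.infinitePi ν, RegularPath x := by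
  have : Nonempty ι := ⟨σ 0⟩
  choose κ hκ hκ2 using fun i => exists_isPeriodLaw (hlam i) (hs i) (hmu i)
  -- The largest mean is still below `1`, so the mean of `exp(-T)` over the first `n` periods
  -- together decays geometrically.
  obtain ⟨i, hi⟩ := Finite.exists_max fun i => ∫⁻ p, expNegLength p ∂κ i
  have hC := (hκ2 i).lintegral_expNegLength_lt_one (hlam i)
  have hle : ∀ k, ∫⁻ p, expNegLength p ∂ν k ≤ ∫⁻ p, expNegLength p ∂κ i := fun k => by
    rw [(hν k).lintegral_expNegLength_eq (hκ2 (σ k)) (hlam _) (hs _) (hmu _)]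
    exact hi (σ k)
  have hzero := ae_iInf_prod_eq_zero ν (fun _ => expNegLength) (fun _ => measurable_expNegLength)
    (tendsto_of_tendsto_of_tendsto_of_le_of_le tendsto_const_nhds
      (ENNReal.tendsto_pow_atTop_nhds_zero_of_lt_one hC) (fun _ => zero_le) fun n => by
        have := Finset.prod_le_pow_card (Finset.range n) (fun k => ∫⁻ p, expNegLength p ∂ν k) _
          fun k _ => hle k
        simpa using this)
  have hreg : ∀ᵐ x ∂Measure.infinitePi ν, ∀ k, RegularShocks (x k).1 := by
    refine ae_all_iff.2 fun k => ?_
    have h := (hν k).ae_regularShocks (hlam _) (hs _)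
    rw [← Measure.infinitePi_map_eval ν k] at h
    exact ae_of_ae_map (measurable_pi_apply k).aemeasurable h
  filter_upwards [hreg, hzero] with x h1 h2
  refine ⟨h1, fun t => ?_⟩
  by_cases hfin : ∀ k, (x k).2 ≠ ⊤
  · have h3 : ⨅ n, ∏ k ∈ Finset.range n, expNegLength (x k)
        < ENNReal.ofReal (Real.exp (-(t : ℝ))) := by
      rw [h2]
      exact ENNReal.ofReal_pos.2 (Real.exp_pos _)
    obtain ⟨n, hn⟩ := iInf_lt_iff.1 h3
    refine ⟨n, ?_⟩
    have h4 : ∀ k, expNegLength (x k) = ENNReal.ofReal (Real.exp (-(x k).2.toReal)) := fun k =>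
      Set.indicator_of_mem (show x k ∈ {p : (ℕ → ℝ) × ℝ≥0∞ | p.2 ≠ ⊤} from hfin k) _
    rw [Finset.prod_congr rfl fun k _ => h4 k,
      ← ENNReal.ofReal_prod_of_nonneg fun k _ => (Real.exp_pos _).le, ← Real.exp_sum,
      ENNReal.ofReal_lt_ofReal_iff (Real.exp_pos _), Real.exp_lt_exp, Finset.sum_neg_distrib,
      neg_lt_neg_iff, ← ENNReal.toReal_sum fun k _ => hfin k] at hn
    have h5 : pathTime x n ≠ ⊤ := ENNReal.sum_ne_top.2 fun k _ => hfin k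
    exact (ENNReal.toReal_lt_toReal ENNReal.coe_ne_top h5).1 hn
  · push Not at hfin
    obtain ⟨k, hk⟩ := hfin
    refine ⟨k + 1, ?_⟩
    rw [pathTime_succ, hk]
    simp

end RegularPaths

/-! ### The counting, drift, jump and density functionals on path space. -/

section PathFunctionals

/-- The number of switchings up to time `t`. -/
def pathCount (t : ℝ≥0) (x : ℕ → (ℕ → ℝ) × ℝ≥0∞) : ℕ∞ :=
  {m : ℕ | pathTime x (m + 1) ≤ t}.encard

/-- The number of switchings up to time `t`, as a natural number. -/
def pathPeriod (t : ℝ≥0) (x : ℕ → (ℕ → ℝ) × ℝ≥0∞) : ℕ := (pathCount t x).toNat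

/-- The time elapsed at `t` since the last switching. -/
def pathElapsed (t : ℝ≥0) (x : ℕ → (ℕ → ℝ) × ℝ≥0∞) : ℝ :=
  t - (pathTime x (pathPeriod t x)).toReal

/-- The number of shocks since the last switching. -/
def pathShocks (t : ℝ≥0) (x : ℕ → (ℕ → ℝ) × ℝ≥0∞) : ℕ∞ :=
  shockCount (x (pathPeriod t x)).1 (pathElapsed t x)

/-- The piecewise linear motion along a path. -/
def pathDrift (a : ℕ → ℕ → ℝ) (t : ℝ≥0) (x : ℕ → (ℕ → ℝ) × ℝ≥0∞) : ℝ :=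
  ∑ m ∈ Finset.range (pathPeriod t x), shockIntegral (a m) (x m).1 (x m).2.toReal
    + shockIntegral (a (pathPeriod t x)) (x (pathPeriod t x)).1 (pathElapsed t x)

/-- The jump component along a path, with the amplitudes `y`. -/
def pathJumps (t : ℝ≥0) (x : ℕ → (ℕ → ℝ) × ℝ≥0∞) (y : (ℕ → ℕ → ℝ) × (ℕ → ℕ → ℝ)) : ℝ :=
  ∑ m ∈ Finset.range (pathPeriod t x),
      (y.2 m (shockCount (x m).1 (x m).2.toReal).toNat
        + ∑ n ∈ Finset.range (shockCount (x m).1 (x m).2.toReal).toNat, y.1 m n)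
    + ∑ n ∈ Finset.range (pathShocks t x).toNat, y.1 (pathPeriod t x) n

/-- The density of a path at time `t`. -/
def pathDensity (c r R : ℕ → ℕ → ℝ) (t : ℝ≥0) (x : ℕ → (ℕ → ℝ) × ℝ≥0∞) : ℝ :=
  (∏ m ∈ Finset.range (pathPeriod t x), completedWeight (c m) (r m) (R m) (x m))
    * periodWeight (c (pathPeriod t x)) (r (pathPeriod t x)) (x (pathPeriod t x)).1
      (pathElapsed t x)

theorem lt_pathCount_iff (x : ℕ → (ℕ → ℝ) × ℝ≥0∞) (k : ℕ) (t : ℝ≥0) :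
    (k : ℕ∞) < pathCount t x ↔ pathTime x (k + 1) ≤ t := by
  constructor
  · intro h
    by_contra hk
    have hsub : {m : ℕ | pathTime x (m + 1) ≤ t} ⊆ (Finset.range k : Set ℕ) := by
      intro n hn
      simp only [Finset.coe_range, Set.mem_Iio]
      by_contra hkn
      exact hk ((pathTime_mono x (by omega : k + 1 ≤ n + 1)).trans hn)
    have := Set.encard_le_encard hsub
    rw [Set.encard_coe_eq_coe_finsetCard, Finset.card_range] at this
    exact absurd h (not_lt.2 this)
  · intro h
    have hsub : (Finset.range (k + 1) : Set ℕ) ⊆ {m : ℕ | pathTime x (m + 1) ≤ t} := by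
      intro n hn
      simp only [Finset.coe_range, Set.mem_Iio] at hn
      exact (pathTime_mono x (by omega : n + 1 ≤ k + 1)).trans h
    have := Set.encard_le_encard hsub
    rw [Set.encard_coe_eq_coe_finsetCard, Finset.card_range] at this
    refine lt_of_lt_of_le ?_ this
    exact_mod_cast Nat.lt_succ_self k

theorem pathCount_eq {x : ℕ → (ℕ → ℝ) × ℝ≥0∞} {m : ℕ} {t : ℝ≥0} (h : x ∈ inPeriod m t) :
    pathCount t x = m := by
  refine le_antisymm (not_lt.1 fun h' => not_le.2 h.2 ((lt_pathCount_iff x m t).1 h')) ?_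
  cases m with
  | zero => simp
  | succ m =>
    have := (lt_pathCount_iff x m t).2 h.1
    exact_mod_cast Order.add_one_le_of_lt this

theorem pathPeriod_eq {x : ℕ → (ℕ → ℝ) × ℝ≥0∞} {m : ℕ} {t : ℝ≥0} (h : x ∈ inPeriod m t) :
    pathPeriod t x = m := by
  rw [pathPeriod, pathCount_eq h, ENat.toNat_natCast]

theorem pathElapsed_eq {x : ℕ → (ℕ → ℝ) × ℝ≥0∞} {m : ℕ} {t : ℝ≥0} (h : x ∈ inPeriod m t) :
    pathElapsed t x = t - (pathTime x m).toReal := by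
  rw [pathElapsed, pathPeriod_eq h]

theorem toReal_pathTime_le {x : ℕ → (ℕ → ℝ) × ℝ≥0∞} {m : ℕ} {t : ℝ≥0} (h : x ∈ inPeriod m t) :
    (pathTime x m).toReal ≤ t :=
  ENNReal.toReal_le_of_le_ofReal t.coe_nonneg (by simpa using h.1)

theorem measurable_pathCount (t : ℝ≥0) : Measurable (pathCount t) := by
  refine measurable_encard.comp (measurable_set_iff.2 fun n => ?_)
  exact measurable_to_prop (by
    simpa using! measurableSet_le (measurable_pathTime (n + 1)) measurable_const)

theorem measurable_pathPeriod (t : ℝ≥0) : Measurable (pathPeriod t) :=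
  (measurable_pathCount t).enat_comp ENat.toNat

theorem measurable_nat_select {β γ : Type*} [MeasurableSpace β] [MeasurableSpace γ] {f : β → ℕ}
    (hf : Measurable f) {g : ℕ → β → γ} (hg : ∀ n, Measurable (g n)) :
    Measurable fun x => g (f x) x := by
  have h : Measurable fun p : ℕ × β => g p.1 p.2 := measurable_from_prod_countable_right hg
  exact h.comp (hf.prodMk measurable_id)

theorem measurable_pathElapsed (t : ℝ≥0) : Measurable (pathElapsed t) := by
  have h := measurable_nat_select (measurable_pathPeriod t) measurable_pathTime
  unfold pathElapsed
  fun_prop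

theorem measurable_pathShocks (t : ℝ≥0) : Measurable (pathShocks t) := by
  have h := measurable_pathElapsed t
  exact measurable_nat_select (measurable_pathPeriod t)
    (g := fun m x => shockCount (x m).1 (pathElapsed t x)) fun m => by fun_prop

theorem measurable_pathDrift (a : ℕ → ℕ → ℝ) (t : ℝ≥0) : Measurable (pathDrift a t) := by
  have h := measurable_pathElapsed t
  refine (measurable_sum_range (measurable_pathPeriod t)
    (g := fun m x => shockIntegral (a m) (x m).1 (x m).2.toReal) fun m => by fun_prop).add ?_
  exact measurable_nat_select (measurable_pathPeriod t)
    (g := fun m x => shockIntegral (a m) (x m).1 (pathElapsed t x)) fun m => by fun_prop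

theorem measurable_pathDensity (c r R : ℕ → ℕ → ℝ) (t : ℝ≥0) :
    Measurable (pathDensity c r R t) := by
  have h := measurable_pathElapsed t
  refine (measurable_prod_range (measurable_pathPeriod t)
    (g := fun m x => completedWeight (c m) (r m) (R m) (x m)) fun m =>
      (measurable_completedWeight _ _ _).comp (measurable_pi_apply m)).mul ?_
  exact measurable_nat_select (measurable_pathPeriod t)
    (g := fun m x => periodWeight (c m) (r m) (x m).1 (pathElapsed t x)) fun m => by fun_prop

theorem measurable_pathJumps (t : ℝ≥0) :
    Measurable fun p : (ℕ → (ℕ → ℝ) × ℝ≥0∞) × ((ℕ → ℕ → ℝ) × (ℕ → ℕ → ℝ)) =>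
      pathJumps t p.1 p.2 := by
  have hper : Measurable fun p : (ℕ → (ℕ → ℝ) × ℝ≥0∞) × ((ℕ → ℕ → ℝ) × (ℕ → ℕ → ℝ)) =>
      pathPeriod t p.1 := (measurable_pathPeriod t).comp measurable_fst
  have hN : ∀ m, Measurable fun p : (ℕ → (ℕ → ℝ) × ℝ≥0∞) × ((ℕ → ℕ → ℝ) × (ℕ → ℕ → ℝ)) =>
      (shockCount (p.1 m).1 (p.1 m).2.toReal).toNat := fun m => by fun_prop
  have hM : Measurable fun p : (ℕ → (ℕ → ℝ) × ℝ≥0∞) × ((ℕ → ℕ → ℝ) × (ℕ → ℕ → ℝ)) =>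
      (pathShocks t p.1).toNat := ((measurable_pathShocks t).comp measurable_fst).enat_comp _
  refine (measurable_sum_range hper (g := fun m p =>
    p.2.2 m (shockCount (p.1 m).1 (p.1 m).2.toReal).toNat
        + ∑ n ∈ Finset.range (shockCount (p.1 m).1 (p.1 m).2.toReal).toNat, p.2.1 m n)
    fun m => Measurable.add ?_ ?_).add ?_
  · exact measurable_nat_select (hN m) (g := fun n p => p.2.2 m n) fun n => by fun_prop
  · exact measurable_sum_range (hN m) (g := fun n p => p.2.1 m n) fun n => by fun_prop
  · exact measurable_nat_select hper
      (g := fun m p => ∑ n ∈ Finset.range (pathShocks t p.1).toNat, p.2.1 m n) fun m =>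
        measurable_sum_range hM (g := fun n p => p.2.1 m n) fun n => by fun_prop

end PathFunctionals

/-! ### The observation at `t` determines every functional at times `s ≤ t`. -/

section Observation

variable {x : ℕ → (ℕ → ℝ) × ℝ≥0∞} {m m' : ℕ} {s t : ℝ≥0}

theorem observedPath_snd {k : ℕ} (hk : k < m) : (observedPath m t x k).2 = (x k).2 := by
  simp [observedPath, hk]

theorem pathTime_observedPath {k : ℕ} (hk : k ≤ m) :
    pathTime (observedPath m t x) k = pathTime x k :=
  pathTime_congr fun _ hj => observedPath_snd (hj.trans_le hk)

/-- The placeholder length `⊤` of the current period puts all later switchings out of reach. -/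
theorem pathTime_observedPath_of_lt {k : ℕ} (hk : m < k) :
    pathTime (observedPath m t x) k = ⊤ := by
  refine top_le_iff.1 (le_trans ?_ (pathTime_mono _ (Nat.succ_le_of_lt hk)))
  rw [Nat.succ_eq_add_one, pathTime_succ]
  simp [observedPath]

theorem le_of_mem_inPeriod (hs : x ∈ inPeriod m' s) (ht : x ∈ inPeriod m t) (hst : s ≤ t) :
    m' ≤ m := by
  by_contra h
  have h1 := pathTime_mono x (Nat.succ_le_of_lt (not_le.1 h))
  have h2 := ht.2.trans_le (h1.trans hs.1)
  exact absurd (ENNReal.coe_le_coe.2 hst) (not_le.2 h2)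

theorem observedPath_mem_inPeriod (hs : x ∈ inPeriod m' s) (ht : x ∈ inPeriod m t) (hst : s ≤ t) :
    observedPath m t x ∈ inPeriod m' s := by
  have hle := le_of_mem_inPeriod hs ht hst
  refine ⟨by rw [pathTime_observedPath hle]; exact hs.1, ?_⟩
  rcases hle.lt_or_eq with hlt | rfl
  · rw [pathTime_observedPath (Nat.succ_le_of_lt hlt)]
    exact hs.2
  · rw [pathTime_observedPath_of_lt (Nat.lt_succ_self _)]
    exact ENNReal.coe_lt_top

theorem RegularPath.shockCount_observedPath_completed (hx : RegularPath x) {k : ℕ} (hk : k < m)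
    {v : ℝ} (hv : v ≤ (x k).2.toReal) :
    shockCount (observedPath m t x k).1 v = shockCount (x k).1 v := by
  simp only [observedPath, if_pos hk]
  exact shockCount_observed (fun n => ((hx.shocks k).pos n).le) ENNReal.toReal_nonneg hv

/-- The period current at `s` may have ended by `t`. Then its age at `s` is less than its length, up
to which its shocks are observed; otherwise its age at `s` is at most its age at `t`. -/
theorem RegularPath.shockCount_observedPath_current (hx : RegularPath x) (hs : x ∈ inPeriod m' s)
    (ht : x ∈ inPeriod m t) (hst : s ≤ t) {v : ℝ} (hv : v ≤ s - (pathTime x m').toReal) :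
    shockCount (observedPath m t x m').1 v = shockCount (x m').1 v := by
  rcases (le_of_mem_inPeriod hs ht hst).lt_or_eq with hlt | rfl
  · refine hx.shockCount_observedPath_completed hlt (hv.trans ?_)
    have h1 := ne_top_of_mem_inPeriod ht hlt
    have h2 : pathTime x m' ≠ ⊤ := ne_top_of_le_ne_top ENNReal.coe_ne_top hs.1
    have h3 := hs.2
    rw [pathTime_succ] at h3
    have h4 := (ENNReal.toReal_lt_toReal ENNReal.coe_ne_top (ENNReal.add_ne_top.2 ⟨h2, h1⟩)).2 h3
    rw [ENNReal.toReal_add h2 h1, ENNReal.coe_toReal] at h4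
    linarith
  · simp only [observedPath, lt_irrefl, if_false, if_true]
    have hst' : (s : ℝ) ≤ t := hst
    refine shockCount_observed (fun n => ((hx.shocks m').pos n).le)
      (sub_nonneg.2 (toReal_pathTime_le ht)) (by linarith)

theorem pathCount_observedPath (hs : x ∈ inPeriod m' s) (ht : x ∈ inPeriod m t) (hst : s ≤ t) :
    pathCount s (observedPath m t x) = pathCount s x := by
  rw [pathCount_eq hs, pathCount_eq (observedPath_mem_inPeriod hs ht hst)]

theorem pathElapsed_observedPath (hs : x ∈ inPeriod m' s) (ht : x ∈ inPeriod m t) (hst : s ≤ t) :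
    pathElapsed s (observedPath m t x) = pathElapsed s x := by
  rw [pathElapsed_eq hs, pathElapsed_eq (observedPath_mem_inPeriod hs ht hst),
    pathTime_observedPath (le_of_mem_inPeriod hs ht hst)]

theorem RegularPath.pathShocks_observedPath (hx : RegularPath x) (hs : x ∈ inPeriod m' s)
    (ht : x ∈ inPeriod m t) (hst : s ≤ t) :
    pathShocks s (observedPath m t x) = pathShocks s x := by
  have ho := observedPath_mem_inPeriod hs ht hst
  rw [pathShocks, pathShocks, pathElapsed_observedPath hs ht hst, pathPeriod_eq hs,
    pathPeriod_eq ho]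
  exact hx.shockCount_observedPath_current hs ht hst (pathElapsed_eq hs).le

theorem RegularPath.pathDrift_observedPath (hx : RegularPath x) (a : ℕ → ℕ → ℝ)
    (hs : x ∈ inPeriod m' s) (ht : x ∈ inPeriod m t) (hst : s ≤ t) :
    pathDrift a s (observedPath m t x) = pathDrift a s x := by
  have ho := observedPath_mem_inPeriod hs ht hst
  have hle := le_of_mem_inPeriod hs ht hst
  rw [pathDrift, pathDrift, pathElapsed_observedPath hs ht hst, pathPeriod_eq hs,
    pathPeriod_eq ho]
  congr 1
  · refine Finset.sum_congr rfl fun k hk => ?_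
    have hkm : k < m := (Finset.mem_range.1 hk).trans_le hle
    rw [observedPath_snd hkm]
    exact shockIntegral_congr ENNReal.toReal_nonneg fun v hv =>
      hx.shockCount_observedPath_completed hkm hv
  · rw [pathElapsed_eq hs]
    exact shockIntegral_congr (sub_nonneg.2 (toReal_pathTime_le hs)) fun v hv =>
      hx.shockCount_observedPath_current hs ht hst hv

theorem RegularPath.pathJumps_observedPath (hx : RegularPath x)
    (y : (ℕ → ℕ → ℝ) × (ℕ → ℕ → ℝ)) (hs : x ∈ inPeriod m' s) (ht : x ∈ inPeriod m t)
    (hst : s ≤ t) : pathJumps s (observedPath m t x) y = pathJumps s x y := by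
  have ho := observedPath_mem_inPeriod hs ht hst
  have hle := le_of_mem_inPeriod hs ht hst
  rw [pathJumps, pathJumps, hx.pathShocks_observedPath hs ht hst, pathPeriod_eq hs,
    pathPeriod_eq ho]
  congr 1
  refine Finset.sum_congr rfl fun k hk => ?_
  have hkm : k < m := (Finset.mem_range.1 hk).trans_le hle
  rw [observedPath_snd hkm, hx.shockCount_observedPath_completed hkm le_rfl]

end Observation

/-! ### The density on path space, summed over the current period. -/

section PathDensity

variable {lam mu r R : ℕ → ℕ → ℝ} {ν ν' : ℕ → Measure ((ℕ → ℝ) × ℝ≥0∞)}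

theorem RegularPath.tsum_indicator {x : ℕ → (ℕ → ℝ) × ℝ≥0∞} (hx : RegularPath x) (t : ℝ≥0)
    (f : ℕ → (ℕ → (ℕ → ℝ) × ℝ≥0∞) → ℝ≥0∞) :
    ∑' m, (inPeriod m t).indicator (f m) x = f (pathPeriod t x) x := by
  obtain ⟨m, hm⟩ := hx.exists_inPeriod t
  rw [tsum_eq_single m, Set.indicator_of_mem hm, pathPeriod_eq hm]
  intro k hk
  refine Set.indicator_of_notMem (fun h => hk ?_) _
  rw [← pathPeriod_eq h, pathPeriod_eq hm]

theorem ofReal_pathDensity {c : ℕ → ℕ → ℝ} (hr : ∀ k n, -1 < r k n) (hR : ∀ k n, -1 < R k n)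
    {x : ℕ → (ℕ → ℝ) × ℝ≥0∞} {m : ℕ} {t : ℝ≥0} (h : x ∈ inPeriod m t) :
    ENNReal.ofReal (pathDensity c r R t x) = tailWeight c r R m t 0 x := by
  have hpos : ∀ k, 0 < completedWeight (c k) (r k) (R k) (x k) := fun k =>
    completedWeight_pos (hr k) (hR k) (x k)
  rw [pathDensity, pathElapsed_eq h, pathPeriod_eq h,
    ENNReal.ofReal_mul (Finset.prod_nonneg fun k _ => (hpos k).le),
    ENNReal.ofReal_prod_of_nonneg fun k _ => (hpos k).le]
  simp [tailWeight, Nat.Ico_zero_eq_range]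

/-- The density of the path law for the changed intensities, on the events determined by the
observation up to time `t`. -/
theorem setLIntegral_pathDensity [∀ k, IsProbabilityMeasure (ν k)]
    [∀ k, IsProbabilityMeasure (ν' k)]
    (hν : ∀ k, IsPeriodLaw (ν k) (lam k) (mu k))
    (hν' : ∀ k, IsPeriodLaw (ν' k) (fun n => lam k n * (1 + r k n)) fun n => mu k n * (1 + R k n))
    (hlam : ∀ k n, 0 < lam k n) (hr : ∀ k n, -1 < r k n) (hmu : ∀ k n, 0 < mu k n)
    (hR : ∀ k n, -1 < R k n) (hs : ∀ k, ¬ Summable fun n => (lam k n)⁻¹)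
    (hs' : ∀ k, ¬ Summable fun n => (lam k n * (1 + r k n))⁻¹)
    (hreg : ∀ᵐ x ∂Measure.infinitePi ν, RegularPath x)
    (hreg' : ∀ᵐ x ∂Measure.infinitePi ν', RegularPath x)
    (t : ℝ≥0) {B : Set (ℕ → (ℕ → ℝ) × ℝ≥0∞)} (hB : MeasurableSet B)
    (hdet : ∀ m x, RegularPath x → x ∈ inPeriod m t → (observedPath m t x ∈ B ↔ x ∈ B)) :
    ∫⁻ x in B, ENNReal.ofReal
        (pathDensity (fun k => compensator (lam k) (mu k) (r k) (R k)) r R t x)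
          ∂Measure.infinitePi ν
      = Measure.infinitePi ν' B := by
  let c : ℕ → ℕ → ℝ := fun k => compensator (lam k) (mu k) (r k) (R k)
  let F : (ℕ → (ℕ → ℝ) × ℝ≥0∞) → ℝ≥0∞ := B.indicator 1
  have hF : Measurable F := measurable_one.indicator hB
  have hL := lintegral_tsum (μ := Measure.infinitePi ν) (f := fun m =>
    (inPeriod m t).indicator fun x => tailWeight c r R m t 0 x * F (observedPath m t x))
    (fun m => (((measurable_tailWeight c r R m t 0).mul
      (hF.comp (measurable_observedPath m t))).indicator (measurableSet_inPeriod m t)).aemeasurable)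
  have hR' := lintegral_tsum (μ := Measure.infinitePi ν') (f := fun m =>
    (inPeriod m t).indicator fun x => F (observedPath m t x))
    (fun m => ((hF.comp (measurable_observedPath m t)).indicator
      (measurableSet_inPeriod m t)).aemeasurable)
  rw [tsum_congr fun m => lintegral_inPeriod_exchange hν hν' hlam hr hmu hR hs hs' m t hF,
    ← hR'] at hL
  -- The exchange only admits functions of the observed path; determinedness of `B` makes its
  -- indicator one of these.
  have hFD : ∀ m x, RegularPath x → x ∈ inPeriod m t → F (observedPath m t x) = F x := by
    intro m x h1 h2
    have := hdet m x h1 h2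
    by_cases hx : x ∈ B
    · simp only [F, Set.indicator_of_mem hx, Set.indicator_of_mem (this.2 hx), Pi.one_apply]
    · simp only [F, Set.indicator_of_notMem hx, Set.indicator_of_notMem fun h => hx (this.1 h)]
  rw [← lintegral_indicator hB, ← lintegral_indicator_one hB]
  refine Eq.trans (lintegral_congr_ae ?_) (hL.trans (lintegral_congr_ae ?_))
  · filter_upwards [hreg] with x hx
    rw [hx.tsum_indicator t fun m x => tailWeight c r R m t 0 x * F (observedPath m t x)]
    obtain ⟨m, hm⟩ := hx.exists_inPeriod t
    rw [pathPeriod_eq hm, hFD m x hx hm, ← ofReal_pathDensity hr hR hm]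
    by_cases hxB : x ∈ B
    · simp [F, hxB, c]
    · simp [F, hxB]
  · filter_upwards [hreg'] with x hx
    rw [hx.tsum_indicator t fun m x => F (observedPath m t x)]
    obtain ⟨m, hm⟩ := hx.exists_inPeriod t
    rw [pathPeriod_eq hm, hFD m x hx hm]

end PathDensity

/-! ### The history as a sub-σ-algebra of the events determined by observation. -/

section PathHistory

/-- The events determined by the observation of a regular path up to time `t` and the jump
amplitudes. -/
@[reducible] def determinedSets (t : ℝ≥0) :
    MeasurableSpace ((ℕ → (ℕ → ℝ) × ℝ≥0∞) × ((ℕ → ℕ → ℝ) × (ℕ → ℕ → ℝ))) where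
  MeasurableSet' B := MeasurableSet B ∧ ∀ m x y, RegularPath x → x ∈ inPeriod m t →
    ((observedPath m t x, y) ∈ B ↔ (x, y) ∈ B)
  measurableSet_empty := ⟨MeasurableSet.empty, by simp⟩
  measurableSet_compl B hB := ⟨hB.1.compl, fun m x y hx hm => not_congr (hB.2 m x y hx hm)⟩
  measurableSet_iUnion f hf := ⟨MeasurableSet.iUnion fun i => (hf i).1, fun m x y hx hm => by
    simp only [Set.mem_iUnion, (hf _).2 m x y hx hm]⟩

theorem comap_le_determinedSets {γ : Type*} [mγ : MeasurableSpace γ] {t : ℝ≥0}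
    {g : (ℕ → (ℕ → ℝ) × ℝ≥0∞) × ((ℕ → ℕ → ℝ) × (ℕ → ℕ → ℝ)) → γ} (hg : Measurable g)
    (hinv : ∀ m x y, RegularPath x → x ∈ inPeriod m t →
      g (observedPath m t x, y) = g (x, y)) :
    MeasurableSpace.comap g mγ ≤ determinedSets t := by
  rintro _ ⟨s, hs, rfl⟩
  exact ⟨hg hs, fun m x y hx hm => by simp only [Set.mem_preimage, hinv m x y hx hm]⟩

variable (i₀ : ZMod 2) (c : ZMod 2 → ℕ → ℝ)

/-- The value of the piecewise linear process along a path. -/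
def pathX (t : ℝ≥0) (p : (ℕ → (ℕ → ℝ) × ℝ≥0∞) × ((ℕ → ℕ → ℝ) × (ℕ → ℕ → ℝ))) : ℝ :=
  pathDrift (fun m => c (pattern i₀ m)) t p.1 + pathJumps t p.1 p.2

/-- The history of the process on the space of paths and jump amplitudes. -/
@[reducible] def pathHistory (t : ℝ≥0) :
    MeasurableSpace ((ℕ → (ℕ → ℝ) × ℝ≥0∞) × ((ℕ → ℕ → ℝ) × (ℕ → ℕ → ℝ))) :=
  ⨆ s : Set.Iic t,
    MeasurableSpace.comap (fun p => pathCount s p.1) ⊤ ⊔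
      MeasurableSpace.comap (fun p => pattern i₀ (pathPeriod s p.1)) ⊤ ⊔
      MeasurableSpace.comap (fun p => pathShocks s p.1) ⊤ ⊔
      MeasurableSpace.comap (pathX i₀ c s) (borel ℝ)

theorem pathHistory_mono {s t : ℝ≥0} (hst : s ≤ t) : pathHistory i₀ c s ≤ pathHistory i₀ c t :=
  iSup_le fun v => le_iSup_of_le (⟨v, le_trans v.2 hst⟩ : Set.Iic t) le_rfl

/-- Invariance under `observedPath` need only be checked for the generating functionals, since the
determined events already form a σ-algebra. -/
theorem pathHistory_le_determinedSets (t : ℝ≥0) : pathHistory i₀ c t ≤ determinedSets t := by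
  refine iSup_le fun ⟨s, hst⟩ => sup_le (sup_le (sup_le ?_ ?_) ?_) ?_
  · refine comap_le_determinedSets (mγ := ⊤) (by
      exact (measurable_pathCount s).comp measurable_fst) fun m x y hx hm => ?_
    obtain ⟨m', hm'⟩ := hx.exists_inPeriod s
    exact pathCount_observedPath hm' hm hst
  · refine comap_le_determinedSets (mγ := ⊤) ?_ fun m x y hx hm => ?_
    · have h : @Measurable ℕ (ZMod 2) _ ⊤ (pattern i₀) := measurable_from_top
      exact h.comp ((measurable_pathPeriod s).comp measurable_fst)
    · obtain ⟨m', hm'⟩ := hx.exists_inPeriod s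
      simp only [pathPeriod, pathCount_observedPath hm' hm hst]
  · refine comap_le_determinedSets (mγ := ⊤) (by
      exact (measurable_pathShocks s).comp measurable_fst) fun m x y hx hm => ?_
    obtain ⟨m', hm'⟩ := hx.exists_inPeriod s
    exact hx.pathShocks_observedPath hm' hm hst
  · refine comap_le_determinedSets (mγ := borel ℝ) ?_ fun m x y hx hm => ?_
    · rw [← BorelSpace.measurable_eq (α := ℝ)]
      exact ((measurable_pathDrift _ s).comp measurable_fst).add (measurable_pathJumps s)
    · obtain ⟨m', hm'⟩ := hx.exists_inPeriod s
      simp only [pathX]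
      rw [hx.pathDrift_observedPath _ hm' hm hst, hx.pathJumps_observedPath y hm' hm hst]

theorem measurableSet_pathTime_le {s t : ℝ≥0} (hst : s ≤ t) (k : ℕ) :
    MeasurableSet[pathHistory i₀ c t]
      {p : (ℕ → (ℕ → ℝ) × ℝ≥0∞) × ((ℕ → ℕ → ℝ) × (ℕ → ℕ → ℝ)) | pathTime p.1 k ≤ s} := by
  cases k with
  | zero =>
    simp only [pathTime, Finset.range_zero, Finset.sum_empty, zero_le, Set.ofPred_true]
    exact MeasurableSet.univ
  | succ k =>
    have hle : MeasurableSpace.comap (fun p : (ℕ → (ℕ → ℝ) × ℝ≥0∞) ×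
        ((ℕ → ℕ → ℝ) × (ℕ → ℕ → ℝ)) => pathCount s p.1) ⊤ ≤ pathHistory i₀ c t :=
      le_iSup_of_le (⟨s, hst⟩ : Set.Iic t) (le_sup_left.trans (le_sup_left.trans le_sup_left))
    refine hle _ ⟨{n | (k : ℕ∞) < n}, trivial, ?_⟩
    ext p
    exact lt_pathCount_iff p.1 k s

/-- The lengths of the first periods are observed. -/
theorem measurableSet_lengths_le (k : ℕ) (u : ℕ → ℝ≥0) {t : ℝ≥0}
    (hut : ∑ m ∈ Finset.range k, u m ≤ t) :
    MeasurableSet[pathHistory i₀ c t]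
      {p : (ℕ → (ℕ → ℝ) × ℝ≥0∞) × ((ℕ → ℕ → ℝ) × (ℕ → ℕ → ℝ)) | ∀ m < k, (p.1 m).2 ≤ u m} := by
  -- The switching times need not be known at `t`, but their truncations at `t` are. The bounds `u`
  -- force the first `k` switchings before `t`, where the truncation has no effect.
  let Y : ℕ → (ℕ → (ℕ → ℝ) × ℝ≥0∞) × ((ℕ → ℕ → ℝ) × (ℕ → ℕ → ℝ)) → ℝ≥0∞ :=
    fun j p => min (pathTime p.1 j) t
  have hY : ∀ j, Measurable[pathHistory i₀ c t] (Y j) := by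
    intro j
    refine measurable_of_Iic fun a => ?_
    rcases le_or_gt (t : ℝ≥0∞) a with ha | ha
    · have : Y j ⁻¹' Set.Iic a = Set.univ :=
        Set.eq_univ_of_forall fun p => (min_le_right _ _).trans ha
      rw [this]
      exact MeasurableSet.univ
    · lift a to ℝ≥0 using ne_top_of_lt ha
      have : Y j ⁻¹' Set.Iic (a : ℝ≥0∞)
          = {p | pathTime p.1 j ≤ a} := by
        ext p
        simp only [Y, Set.mem_preimage, Set.mem_Iic, min_le_iff, Set.mem_ofPred_eq]
        exact or_iff_left (not_le.2 ha)
      rw [this]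
      exact measurableSet_pathTime_le i₀ c (ENNReal.coe_le_coe.1 ha.le) j
  have hset : {p : (ℕ → (ℕ → ℝ) × ℝ≥0∞) × ((ℕ → ℕ → ℝ) × (ℕ → ℕ → ℝ)) | ∀ m < k, (p.1 m).2 ≤ u m}
      = {p | pathTime p.1 k ≤ t} ∩ ⋂ m ∈ Finset.range k, {p | Y (m + 1) p ≤ Y m p + u m} := by
    have hstep : ∀ p : (ℕ → (ℕ → ℝ) × ℝ≥0∞) × ((ℕ → ℕ → ℝ) × (ℕ → ℕ → ℝ)),
        pathTime p.1 k ≤ t → ∀ m < k, (Y (m + 1) p ≤ Y m p + u m ↔ (p.1 m).2 ≤ u m) := by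
      intro p hp m hm
      have h1 : pathTime p.1 (m + 1) ≤ t := (pathTime_mono p.1 (Nat.succ_le_of_lt hm)).trans hp
      have h2 : pathTime p.1 m ≤ t := (pathTime_mono p.1 hm.le).trans hp
      simp only [Y, min_eq_left h1, min_eq_left h2, pathTime_succ]
      exact ENNReal.add_le_add_iff_left (ne_top_of_le_ne_top ENNReal.coe_ne_top h2)
    ext p
    simp only [Set.mem_ofPred_eq, Set.mem_inter_iff, Set.mem_iInter, Finset.mem_range]
    constructor
    · intro h
      have hp : pathTime p.1 k ≤ t := by
        refine (Finset.sum_le_sum fun m hm => h m (Finset.mem_range.1 hm)).trans ?_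
        exact_mod_cast hut
      exact ⟨hp, fun m hm => (hstep p hp m hm).2 (h m hm)⟩
    · rintro ⟨hp, h⟩ m hm
      exact (hstep p hp m hm).1 (h m hm)
  rw [hset]
  refine MeasurableSet.inter (measurableSet_pathTime_le i₀ c le_rfl k)
    (Finset.measurableSet_biInter _ fun m _ => ?_)
  exact measurableSet_le (hY (m + 1)) ((hY m).add_const _)

end PathHistory

/-! ### Transfer from the probability space to path space. -/

namespace SwitchingModel

variable {Ω : Type*} [MeasurableSpace Ω] {P : Measure Ω} (S : SwitchingModel P)

/-- The shocks and the lengths of the holding periods. -/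
def path (ω : Ω) (m : ℕ) : (ℕ → ℝ) × ℝ≥0∞ := (fun n => S.τ m n ω, S.T m ω)

/-- The jump amplitudes. -/
def amplitudes (ω : Ω) : (ℕ → ℕ → ℝ) × (ℕ → ℕ → ℝ) :=
  (fun m n => S.r m n ω, fun m n => S.R m n ω)

/-- The path together with the jump amplitudes. -/
def pathData (ω : Ω) : (ℕ → (ℕ → ℝ) × ℝ≥0∞) × ((ℕ → ℕ → ℝ) × (ℕ → ℕ → ℝ)) :=
  (S.path ω, S.amplitudes ω)

theorem measurable_period_data (m : ℕ) :
    Measurable fun ω => ((fun n => S.τ m n ω), S.T m ω) :=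
  (measurable_pi_iff.2 fun n => S.measurable_τ m n).prodMk (S.measurable_T m)

theorem measurable_path : Measurable S.path :=
  measurable_pi_iff.2 fun m => S.measurable_period_data m

theorem measurable_amplitudes : Measurable S.amplitudes :=
  (measurable_pi_iff.2 fun m => measurable_pi_iff.2 fun n => S.measurable_r m n).prodMk
    (measurable_pi_iff.2 fun m => measurable_pi_iff.2 fun n => S.measurable_R m n)

theorem measurable_pathData : Measurable S.pathData :=
  S.measurable_path.prodMk S.measurable_amplitudes

theorem history_eq_comap (t : ℝ≥0) :
    S.history t = MeasurableSpace.comap S.pathData (pathHistory S.i₀ S.c t) := by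
  simp only [history, pathHistory, MeasurableSpace.comap_iSup, MeasurableSpace.comap_sup,
    MeasurableSpace.comap_comp]
  rfl

/-- Splitting the exponential of the drift over the periods collects, for each period, its own
exponential and its own jump factors. -/
theorem Z_eq_pathDensity (rStar RStar : ZMod 2 → ℕ → ℝ) (t : ℝ≥0) (ω : Ω) :
    S.Z rStar RStar t ω = pathDensity
      (fun k => compensator (S.lam (pattern S.i₀ k)) (S.mu (pattern S.i₀ k))
        (rStar (pattern S.i₀ k)) (RStar (pattern S.i₀ k)))
      (fun k => rStar (pattern S.i₀ k)) (fun k => RStar (pattern S.i₀ k)) t (S.path ω) := by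
  have hper : pathPeriod t (S.path ω) = S.period t ω := rfl
  have hel : pathElapsed t (S.path ω) = S.elapsed t ω := rfl
  simp only [pathDensity, hper, hel, completedWeight, periodWeight, Z, drift, Real.exp_add,
    Real.exp_sum, Finset.prod_mul_distrib]
  change _ * _ * (_ * _) * _ = (_ * _) * _ * (_ * _)
  have h1 : ∀ m, compensator (S.lam (pattern S.i₀ m)) (S.mu (pattern S.i₀ m))
      (rStar (pattern S.i₀ m)) (RStar (pattern S.i₀ m)) = S.cStar rStar RStar (pattern S.i₀ m) :=
    fun m => rfl
  simp only [h1, state, currentShocks, periodShocks, path]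
  ring

theorem map_τ [IsProbabilityMeasure P] (m : ℕ) :
    P.map (fun ω n => S.τ m n ω) = shockLaw (S.lam (pattern S.i₀ m)) := by
  have h := (iIndepFun_iff_map_fun_eq_infinitePi_map (S.measurable_τ m)).1 (S.indep_τ m)
  rw [h]
  simp only [S.law_τ]

theorem isPeriodLaw [IsProbabilityMeasure P] (m : ℕ) :
    IsPeriodLaw (P.map fun ω => ((fun n => S.τ m n ω), S.T m ω))
      (S.lam (pattern S.i₀ m)) (S.mu (pattern S.i₀ m)) := by
  intro u B hB
  have hτ : Measurable fun ω => fun n => S.τ m n ω :=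
    measurable_pi_iff.2 fun n => S.measurable_τ m n
  have hset : MeasurableSet {ω | (u : ℝ≥0∞) < S.T m ω} :=
    measurableSet_lt measurable_const (S.measurable_T m)
  have hsm : MeasurableSet ((fun ω => fun n => S.τ m n ω) ⁻¹' B) := hτ hB
  have hint : Integrable ({ω | (u : ℝ≥0∞) < S.T m ω}.indicator fun _ => (1 : ℝ)) P :=
    (integrable_const 1).indicator hset
  -- Integrating the conditional survivor function over an event of the shocks gives the defining
  -- identity of `IsPeriodLaw`.
  have h1 := setIntegral_condExp (m := MeasurableSpace.comap (fun ω n => S.τ m n ω)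
    MeasurableSpace.pi) hτ.comap_le hint ⟨B, hB, rfl⟩
  have h2 : ∫ ω in (fun ω => fun n => S.τ m n ω) ⁻¹' B,
      ({ω | (u : ℝ≥0∞) < S.T m ω}.indicator fun _ => (1 : ℝ)) ω ∂P
      = P.real ((fun ω => fun n => S.τ m n ω) ⁻¹' B ∩ {ω | (u : ℝ≥0∞) < S.T m ω}) := by
    rw [setIntegral_indicator hset]
    simp
  rw [h2, setIntegral_congr_ae hsm ((S.cond_T m u).mono fun ω h _ => h)] at h1
  have hd : Measurable fun e : ℕ → ℝ =>
      Real.exp (-shockIntegral (S.mu (pattern S.i₀ m)) e u) := by fun_prop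
  rw [Measure.map_apply (S.measurable_period_data m) (hB.prod measurableSet_Ioi), ← S.map_τ m,
    setLIntegral_map hB hd.ennreal_ofReal hτ]
  have hI : Integrable (fun ω =>
      Real.exp (-shockIntegral (S.mu (pattern S.i₀ m)) (fun n => S.τ m n ω) u)) P :=
    integrable_condExp.congr (S.cond_T m u)
  have h3 := ofReal_integral_eq_lintegral_ofReal (hI.restrict
    (s := (fun ω => fun n => S.τ m n ω) ⁻¹' B))
    (Filter.Eventually.of_forall fun ω => (Real.exp_pos _).le)
  rw [h1, ofReal_measureReal] at h3
  exact h3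

theorem map_path [IsProbabilityMeasure P] :
    P.map S.path
      = Measure.infinitePi fun m => P.map fun ω => ((fun n => S.τ m n ω), S.T m ω) :=
  (iIndepFun_iff_map_fun_eq_infinitePi_map S.measurable_period_data).1 S.indep_periods

theorem map_pathData [IsProbabilityMeasure P] :
    P.map S.pathData = (P.map S.path).prod (P.map S.amplitudes) := by
  have h1 : Measurable fun q : (ℕ → ℕ → ℝ) × (ℕ → ℝ≥0∞) => fun m => (q.1 m, q.2 m) := by fun_prop
  have h2 : IndepFun S.path S.amplitudes P := S.indep_jumps.comp h1 measurable_id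
  exact (indepFun_iff_map_prod_eq_prod_map_map S.measurable_path.aemeasurable
    S.measurable_amplitudes.aemeasurable).1 h2

end SwitchingModel

/-! ### The distribution function of one holding period. -/

section Survival

variable {lam mu : ℕ → ℝ}

theorem exp_neg_shockIntegral_le_one (hmu : ∀ n, 0 < mu n) (e : ℕ → ℝ) (u : ℝ≥0) :
    Real.exp (-shockIntegral mu e u) ≤ 1 := by
  rw [Real.exp_le_one_iff]
  have : 0 ≤ shockIntegral mu e u :=
    intervalIntegral.integral_nonneg_of_forall u.coe_nonneg fun s => (hmu _).le
  linarith

theorem poExpSurvival_mem_Icc (hlam : ∀ n, 0 < lam n) (hmu : ∀ n, 0 < mu n) (u : ℝ≥0) :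
    poExpSurvival lam mu u ∈ Set.Icc (0 : ℝ) 1 := by
  have := fun n => isProbabilityMeasure_expMeasure (hlam n)
  refine ⟨integral_nonneg fun e => (Real.exp_pos _).le, ?_⟩
  refine (integral_mono_of_nonneg (Filter.Eventually.of_forall fun e => (Real.exp_pos _).le)
    (integrable_const 1) (Filter.Eventually.of_forall fun e =>
      exp_neg_shockIntegral_le_one hmu e u)).trans ?_
  simp

theorem IsPeriodLaw.apply_length_le {ν : Measure ((ℕ → ℝ) × ℝ≥0∞)} [IsProbabilityMeasure ν]
    (hν : IsPeriodLaw ν lam mu) (hlam : ∀ n, 0 < lam n) (hmu : ∀ n, 0 < mu n) (u : ℝ≥0) :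
    ν {p | p.2 ≤ u} = ENNReal.ofReal (1 - poExpSurvival lam mu u) := by
  have := fun n => isProbabilityMeasure_expMeasure (hlam n)
  have hm : Measurable fun e : ℕ → ℝ => Real.exp (-shockIntegral mu e u) := by fun_prop
  have hI : Integrable (fun e => Real.exp (-shockIntegral mu e u)) (shockLaw lam) := by
    refine (integrable_const (1 : ℝ)).mono' hm.aestronglyMeasurable
      (Filter.Eventually.of_forall fun e => ?_)
    rw [Real.norm_eq_abs, abs_of_pos (Real.exp_pos _)]
    exact exp_neg_shockIntegral_le_one hmu e u
  have h := hν u Set.univ MeasurableSet.univ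
  rw [Measure.restrict_univ, ← ofReal_integral_eq_lintegral_ofReal hI
    (Filter.Eventually.of_forall fun e => (Real.exp_pos _).le)] at h
  have hset : {p : (ℕ → ℝ) × ℝ≥0∞ | p.2 ≤ u} = (Set.univ ×ˢ Set.Ioi (u : ℝ≥0∞))ᶜ := by
    ext p
    simp
  rw [hset, prob_compl_eq_one_sub (MeasurableSet.univ.prod measurableSet_Ioi), h,
    ENNReal.ofReal_sub _ (poExpSurvival_mem_Icc hlam hmu u).1, ENNReal.ofReal_one]
  rfl

end Survival

/-! ### From joint distribution functions of initial segments to independence. -/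

section JointDistribution

variable {Ω : Type*} [MeasurableSpace Ω] {Q : Measure Ω} [IsProbabilityMeasure Q]
  {T : ℕ → Ω → ℝ≥0∞} {G : ℕ → ℝ≥0 → ℝ}

/-- Marginals of an initial joint distribution function of product form. -/
theorem measureReal_biInter_le_of_initial (hT : ∀ m, Measurable (T m))
    (hG : ∀ m, Filter.Tendsto (G m) Filter.atTop (nhds 1))
    (h : ∀ (k : ℕ) (u : ℕ → ℝ≥0),
      Q.real {ω | ∀ m < k, T m ω ≤ u m} = ∏ m ∈ Finset.range k, G m (u m))
    (s : Finset ℕ) (u : ℕ → ℝ≥0) :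
    Q.real {ω | ∀ m ∈ s, T m ω ≤ u m} = ∏ m ∈ s, G m (u m) := by
  have hnat : Filter.Tendsto (fun n : ℕ => (n : ℝ≥0)) Filter.atTop Filter.atTop :=
    tendsto_natCast_atTop_atTop
  -- Indices outside `s` receive the bound `n`; as `n` grows, their factors tend to `1`.
  have hlim : ∀ (s : Finset ℕ) (k : ℕ), Filter.Tendsto (fun n : ℕ => Q.real
      {ω | ∀ m < k, T m ω ≤ ((if m ∈ s then u m else (n : ℝ≥0) : ℝ≥0) : ℝ≥0∞)}) Filter.atTop
      (nhds (∏ m ∈ Finset.range k, if m ∈ s then G m (u m) else 1)) := by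
    intro s k
    simp only [h k]
    refine tendsto_finsetProd _ fun m _ => ?_
    split_ifs
    · exact tendsto_const_nhds
    · exact (hG m).comp hnat
  -- Taking `s = ∅` shows that the lengths are almost surely finite, so the bounds `n` are
  -- eventually harmless.
  have hfin : ∀ m, ∀ᵐ ω ∂Q, T m ω ≠ ⊤ := by
    intro m
    have h1 := hlim ∅ (m + 1)
    simp only [Finset.notMem_empty, if_false, Finset.prod_const_one] at h1
    have h2 : 1 ≤ Q.real {ω | T m ω ≠ ⊤} := by
      refine le_of_tendsto h1 (Filter.Eventually.of_forall fun n => ?_)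
      exact measureReal_mono fun ω hω =>
        ne_top_of_le_ne_top ENNReal.coe_ne_top (hω m (Nat.lt_succ_self m))
    have h3 : MeasurableSet {ω | T m ω ≠ ⊤} := ((hT m) (measurableSet_singleton ⊤)).compl
    refine (mem_ae_iff_prob_eq_one h3).2 (le_antisymm prob_le_one ?_)
    have h4 := ENNReal.ofReal_le_ofReal h2
    rwa [ENNReal.ofReal_one, ofReal_measureReal] at h4
  obtain ⟨k, hk⟩ : ∃ k, s ⊆ Finset.range k := ⟨s.sup id + 1, fun m hm =>
    Finset.mem_range.2 (Nat.lt_succ_of_le (Finset.le_sup (f := id) hm))⟩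
  let A : ℕ → Set Ω := fun n =>
    {ω | ∀ m < k, T m ω ≤ ((if m ∈ s then u m else (n : ℝ≥0) : ℝ≥0) : ℝ≥0∞)}
  have hA : Monotone A := by
    intro n n' hn ω hω m hm
    refine (hω m hm).trans (ENNReal.coe_le_coe.2 ?_)
    split_ifs
    · exact le_rfl
    · exact_mod_cast hn
  have hU : (⋃ n, A n : Set Ω) =ᵐ[Q] {ω | ∀ m ∈ s, T m ω ≤ u m} := by
    filter_upwards [ae_all_iff.2 hfin] with ω hω
    refine propext ⟨fun h => ?_, fun h => ?_⟩
    · obtain ⟨n, hn⟩ := Set.mem_iUnion.1 h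
      intro m hm
      have := hn m (Finset.mem_range.1 (hk hm))
      rwa [if_pos hm] at this
    · obtain ⟨n, hn⟩ := ENNReal.exists_nat_gt
        (ENNReal.sum_ne_top.2 fun m (_ : m ∈ Finset.range k) => hω m)
      refine Set.mem_iUnion.2 ⟨n, fun m hm => ?_⟩
      split_ifs with hms
      · exact h m hms
      · refine le_trans (Finset.single_le_sum (f := fun m => T m ω) (fun _ _ => zero_le)
          (Finset.mem_range.2 hm)) ?_
        simpa using hn.le
  have h1 := (ENNReal.tendsto_toReal (measure_ne_top Q _)).comp
    (tendsto_measure_iUnion_atTop (μ := Q) hA)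
  rw [measure_congr hU] at h1
  refine (tendsto_nhds_unique h1 (hlim s k)).trans ?_
  rw [← Finset.prod_filter]
  exact Finset.prod_congr (by ext m; simpa using fun hm => Finset.mem_range.1 (hk hm)) fun _ _ => rfl

theorem iIndepFun_of_initial (hT : ∀ m, Measurable (T m))
    (hG : ∀ m, Filter.Tendsto (G m) Filter.atTop (nhds 1))
    (h : ∀ (k : ℕ) (u : ℕ → ℝ≥0),
      Q.real {ω | ∀ m < k, T m ω ≤ u m} = ∏ m ∈ Finset.range k, G m (u m)) :
    iIndepFun T Q := by
  have hmarg := measureReal_biInter_le_of_initial hT hG h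
  have hfin : ∀ (s : Finset ℕ) (u : ℕ → ℝ≥0),
      Q (⋂ m ∈ s, T m ⁻¹' Set.Iic (u m : ℝ≥0∞)) = ∏ m ∈ s, Q (T m ⁻¹' Set.Iic (u m : ℝ≥0∞)) := by
    intro s u
    have h1 : ∀ m, Q.real (T m ⁻¹' Set.Iic (u m : ℝ≥0∞)) = G m (u m) := by
      intro m
      have := hmarg {m} u
      simpa using! this
    have h2 : (⋂ m ∈ s, T m ⁻¹' Set.Iic (u m : ℝ≥0∞)) = {ω | ∀ m ∈ s, T m ω ≤ u m} := by
      ext ω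
      simp
    rw [h2, ← ofReal_measureReal, hmarg s u, ← Finset.prod_congr rfl fun m _ => h1 m,
      ENNReal.ofReal_prod_of_nonneg fun m _ => measureReal_nonneg]
    exact Finset.prod_congr rfl fun m _ => ofReal_measureReal
  refine iIndepSets.iIndep (m := fun m => MeasurableSpace.comap (T m) inferInstance)
    (fun m => (hT m).comap_le) (fun m => Set.range fun a => T m ⁻¹' Set.Iic a) (fun m => ?_)
    (fun m => ?_) ((iIndepSets_iff _ _).2 fun s f hf => ?_)
  · rintro _ ⟨a, rfl⟩ _ ⟨b, rfl⟩ -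
    refine ⟨min a b, ?_⟩
    ext ω
    simp
  · rw [BorelSpace.measurable_eq (α := ℝ≥0∞), borel_eq_generateFrom_Iic,
      MeasurableSpace.comap_generateFrom, ← Set.range_comp]
    rfl
  · choose! a ha using hf
    -- The generating half-lines of `[0, ∞]` include `Set.Iic ⊤`, whose constraint is void; these
    -- indices are dropped to reach finite bounds.
    have h1 : (⋂ m ∈ s, f m) = ⋂ m ∈ s.filter fun m => a m ≠ ⊤,
        T m ⁻¹' Set.Iic ((a m).toNNReal : ℝ≥0∞) := by
      ext ω
      simp only [Set.mem_iInter, Finset.mem_filter, and_imp]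
      refine ⟨fun H m hm hne => ?_, fun H m hm => ?_⟩
      · have := H m hm
        rw [← ha m hm] at this
        rwa [ENNReal.coe_toNNReal hne]
      · rw [← ha m hm]
        by_cases hne : a m = ⊤
        · simp [hne]
        · have := H m hm hne
          rwa [ENNReal.coe_toNNReal hne] at this
    rw [h1, hfin, Finset.prod_filter]
    refine Finset.prod_congr rfl fun m hm => ?_
    rw [← ha m hm]
    split_ifs with hne
    · rw [ENNReal.coe_toNNReal hne]
    · simp [not_not.1 hne]

end JointDistribution

/-! ### The path law with the changed intensities, and the theorem. -/

namespace SwitchingModel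

variable {Ω : Type*} [MeasurableSpace Ω] {P : Measure Ω} (S : SwitchingModel P)

/-- The law of the path and the jump amplitudes with the changed intensities. -/
theorem exists_starLaw [IsProbabilityMeasure P] (rStar RStar : ZMod 2 → ℕ → ℝ)
    (hr : ∀ i n, -1 < rStar i n) (hR : ∀ i n, -1 < RStar i n)
    (hne : ∀ i, ¬ Summable fun n => (S.lamStar rStar i n)⁻¹) :
    ∃ Q : Measure ((ℕ → (ℕ → ℝ) × ℝ≥0∞) × ((ℕ → ℕ → ℝ) × (ℕ → ℕ → ℝ))),
      IsProbabilityMeasure Q ∧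
      (∀ t B, MeasurableSet[pathHistory S.i₀ S.c t] B →
        ∫⁻ ω in S.pathData ⁻¹' B, ENNReal.ofReal (S.Z rStar RStar t ω) ∂P = Q B) ∧
      ∀ (k : ℕ) (u : ℕ → ℝ≥0), Q {p | ∀ m < k, (p.1 m).2 ≤ u m}
        = ∏ m ∈ Finset.range k, ENNReal.ofReal (1 - poExpSurvival (S.lamStar rStar (pattern S.i₀ m))
            (S.muStar RStar (pattern S.i₀ m)) (u m)) := by
  have hlamS : ∀ i n, 0 < S.lamStar rStar i n := fun i n =>
    mul_pos (S.lam_pos i n) (by linarith [hr i n])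
  have hmuS : ∀ i n, 0 < S.muStar RStar i n := fun i n =>
    mul_pos (S.mu_pos i n) (by linarith [hR i n])
  choose κ hκ hκ2 using fun i => exists_isPeriodLaw (hlamS i) (hne i) (hmuS i)
  let ν : ℕ → Measure ((ℕ → ℝ) × ℝ≥0∞) := fun m => P.map fun ω => ((fun n => S.τ m n ω), S.T m ω)
  let ν' : ℕ → Measure ((ℕ → ℝ) × ℝ≥0∞) := fun m => κ (pattern S.i₀ m)
  have hνp : ∀ m, IsProbabilityMeasure (ν m) := fun m =>
    Measure.isProbabilityMeasure_map (S.measurable_period_data m).aemeasurable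
  have hνp' : ∀ m, IsProbabilityMeasure (ν' m) := fun m => hκ _
  have hρ : IsProbabilityMeasure (P.map S.amplitudes) :=
    Measure.isProbabilityMeasure_map S.measurable_amplitudes.aemeasurable
  have hreg := ae_regularPath (pattern S.i₀) (ν := ν) S.isPeriodLaw S.lam_pos S.lam_nonexplosive
    S.mu_pos
  have hreg' := ae_regularPath (pattern S.i₀) (ν := ν') (fun m => hκ2 _) hlamS hne hmuS
  -- The amplitudes keep their law under the change of measure, as `Z` depends on the path only.
  refine ⟨(Measure.infinitePi ν').prod (P.map S.amplitudes), inferInstance, fun t B hB => ?_,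
    fun k u => ?_⟩
  · obtain ⟨hBm, hdet⟩ := pathHistory_le_determinedSets S.i₀ S.c t B hB
    let D := pathDensity
      (fun k => compensator (S.lam (pattern S.i₀ k)) (S.mu (pattern S.i₀ k))
        (rStar (pattern S.i₀ k)) (RStar (pattern S.i₀ k)))
      (fun k => rStar (pattern S.i₀ k)) (fun k => RStar (pattern S.i₀ k)) t
    have hD : Measurable fun p : (ℕ → (ℕ → ℝ) × ℝ≥0∞) × ((ℕ → ℕ → ℝ) × (ℕ → ℕ → ℝ)) =>
        ENNReal.ofReal (D p.1) :=
      ((measurable_pathDensity _ _ _ t).comp measurable_fst).ennreal_ofReal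
    simp only [S.Z_eq_pathDensity]
    calc ∫⁻ ω in S.pathData ⁻¹' B, ENNReal.ofReal (D (S.path ω)) ∂P
        = ∫⁻ p in B, ENNReal.ofReal (D p.1) ∂P.map S.pathData :=
          (setLIntegral_map hBm hD S.measurable_pathData).symm
      _ = ∫⁻ p, B.indicator (fun p => ENNReal.ofReal (D p.1)) p
            ∂(Measure.infinitePi ν).prod (P.map S.amplitudes) := by
          rw [lintegral_indicator hBm, S.map_pathData, S.map_path]
      _ = ∫⁻ y, ∫⁻ x, B.indicator (fun p => ENNReal.ofReal (D p.1)) (x, y)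
            ∂Measure.infinitePi ν ∂P.map S.amplitudes :=
          lintegral_prod_symm' _ (hD.indicator hBm)
      _ = ∫⁻ y, Measure.infinitePi ν' ((fun x => (x, y)) ⁻¹' B) ∂P.map S.amplitudes := by
          -- For frozen amplitudes `y`, the section of `B` is determined by the observed path, so
          -- the path-space density applies to it.
          refine lintegral_congr fun y => ?_
          have hBy : MeasurableSet ((fun x => (x, y)) ⁻¹' B) := measurable_prodMk_right hBm
          have h := setLIntegral_pathDensity (ν := ν) (ν' := ν') S.isPeriodLaw (fun m => hκ2 _)
            (fun m => S.lam_pos _) (fun m => hr _) (fun m => S.mu_pos _) (fun m => hR _)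
            (fun m => S.lam_nonexplosive _) (fun m => hne _) hreg hreg' t hBy
            fun m x hx hm => hdet m x y hx hm
          rw [← h, ← lintegral_indicator hBy]
          rfl
      _ = (Measure.infinitePi ν').prod (P.map S.amplitudes) B :=
          (Measure.prod_apply_symm hBm).symm
  · have hset : {p : (ℕ → (ℕ → ℝ) × ℝ≥0∞) × ((ℕ → ℕ → ℝ) × (ℕ → ℕ → ℝ)) |
        ∀ m < k, (p.1 m).2 ≤ u m}
        = (Set.pi (Finset.range k : Finset ℕ) fun m => {q : (ℕ → ℝ) × ℝ≥0∞ | q.2 ≤ u m})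
          ×ˢ Set.univ := by
      ext p
      simp
    rw [hset, Measure.prod_prod, measure_univ, mul_one, Measure.infinitePi_pi _ fun m _ =>
      measurableSet_le measurable_snd measurable_const]
    exact Finset.prod_congr rfl fun m _ => (hκ2 _).apply_length_le (hlamS _) (hmuS _) (u m)

end SwitchingModel

end

theorem mainTheorem8 {Ω : Type*} [MeasurableSpace Ω] (P : Measure Ω) [IsProbabilityMeasure P]
    (S : SwitchingModel P) (rStar RStar : ZMod 2 → ℕ → ℝ)
    (hr : ∀ i n, -1 < rStar i n) (hR : ∀ i n, -1 < RStar i n)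
    (hne : ∀ i, ¬ Summable fun n => (S.lamStar rStar i n)⁻¹) :
    -- `Z` is a positive density and defines `P_*` consistently on the sets of `ℱ_t`, `t ≥ 0`
    (∀ t ω, 0 < S.Z rStar RStar t ω) ∧
    (∀ t, Integrable (S.Z rStar RStar t) P ∧ ∫ ω, S.Z rStar RStar t ω ∂P = 1) ∧
    (∀ s t : ℝ≥0, s ≤ t → ∀ A : Set Ω, MeasurableSet[S.history s] A →
      ∫ ω in A, S.Z rStar RStar t ω ∂P = ∫ ω in A, S.Z rStar RStar s ω ∂P) ∧
    -- joint distribution of the holding times under `P_*(A) = E[Z(t) 1_A]`, `A ∈ ℱ_t`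
    (∀ (k : ℕ) (u : ℕ → ℝ≥0) (t : ℝ≥0), ∑ m ∈ Finset.range k, u m ≤ t →
      MeasurableSet[S.history t] {ω | ∀ m < k, S.T m ω ≤ u m} ∧
      ∫ ω in {ω | ∀ m < k, S.T m ω ≤ u m}, S.Z rStar RStar t ω ∂P =
        ∏ m ∈ Finset.range k,
          (1 - poExpSurvival (S.lamStar rStar (pattern S.i₀ m))
            (S.muStar RStar (pattern S.i₀ m)) (u m))) ∧
    -- when `P_*` is a measure on `Ω` and the starred distributions are proper
    (∀ Q : Measure Ω, IsProbabilityMeasure Q →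
      (∀ (t : ℝ≥0) (A : Set Ω), MeasurableSet[S.history t] A →
        Q.real A = ∫ ω in A, S.Z rStar RStar t ω ∂P) →
      (∀ i, Filter.Tendsto (poExpSurvival (S.lamStar rStar i) (S.muStar RStar i))
        Filter.atTop (nhds 0)) →
      iIndepFun S.T Q ∧
      ∀ m, HasPoExpLaw Q (S.T m) (S.lamStar rStar (pattern S.i₀ m))
        (S.muStar RStar (pattern S.i₀ m))) := by
  -- `Qs` does not depend on the time, which is the source of both unit mass and consistency of `Z`.
  obtain ⟨Qs, hQs, hdens, hlaw⟩ := S.exists_starLaw rStar RStar hr hR hne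
  have hpos : ∀ t ω, 0 < S.Z rStar RStar t ω := fun t ω => by
    rw [S.Z_eq_pathDensity]
    exact mul_pos (Finset.prod_pos fun k _ => completedWeight_pos (hr _) (hR _) _)
      (periodWeight_pos (hr _) _ _)
  have hmeas : ∀ t, Measurable (S.Z rStar RStar t) := fun t => by
    have h := (measurable_pathDensity
      (fun k => compensator (S.lam (pattern S.i₀ k)) (S.mu (pattern S.i₀ k))
        (rStar (pattern S.i₀ k)) (RStar (pattern S.i₀ k)))
      (fun k => rStar (pattern S.i₀ k)) (fun k => RStar (pattern S.i₀ k)) t).comp S.measurable_path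
    convert! h using 1
    funext ω
    exact S.Z_eq_pathDensity rStar RStar t ω
  have hset : ∀ t B, MeasurableSet[pathHistory S.i₀ S.c t] B →
      ∫ ω in S.pathData ⁻¹' B, S.Z rStar RStar t ω ∂P = Qs.real B := fun t B hB => by
    rw [integral_eq_lintegral_of_nonneg_ae (Filter.Eventually.of_forall fun ω => (hpos t ω).le)
      (hmeas t).aestronglyMeasurable, hdens t B hB]
    rfl
  have hlamS : ∀ i n, 0 < S.lamStar rStar i n := fun i n =>
    mul_pos (S.lam_pos i n) (by linarith [hr i n])
  have hmuS : ∀ i n, 0 < S.muStar RStar i n := fun i n =>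
    mul_pos (S.mu_pos i n) (by linarith [hR i n])
  have hjoint : ∀ (k : ℕ) (u : ℕ → ℝ≥0) (t : ℝ≥0), ∑ m ∈ Finset.range k, u m ≤ t →
      MeasurableSet[S.history t] {ω | ∀ m < k, S.T m ω ≤ u m} ∧
      ∫ ω in {ω | ∀ m < k, S.T m ω ≤ u m}, S.Z rStar RStar t ω ∂P =
        ∏ m ∈ Finset.range k,
          (1 - poExpSurvival (S.lamStar rStar (pattern S.i₀ m))
            (S.muStar RStar (pattern S.i₀ m)) (u m)) := by
    intro k u t hut
    have hB := measurableSet_lengths_le S.i₀ S.c k u hut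
    refine ⟨?_, ?_⟩
    · rw [S.history_eq_comap]
      exact ⟨_, hB, rfl⟩
    · refine (hset t _ hB).trans ?_
      rw [measureReal_def, hlaw, ENNReal.toReal_prod]
      refine Finset.prod_congr rfl fun m _ => ENNReal.toReal_ofReal ?_
      linarith [(poExpSurvival_mem_Icc (hlamS (pattern S.i₀ m)) (hmuS (pattern S.i₀ m)) (u m)).2]
  refine ⟨hpos, fun t => ?_, fun s t hst A hA => ?_, hjoint, fun Q hQ hQZ hproper => ?_⟩
  · have h1 := hdens t Set.univ MeasurableSet.univ
    rw [Set.preimage_univ, Measure.restrict_univ, measure_univ] at h1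
    have h2 := hset t Set.univ MeasurableSet.univ
    rw [Set.preimage_univ, Measure.restrict_univ, probReal_univ] at h2
    refine ⟨⟨(hmeas t).aestronglyMeasurable, ?_⟩, h2⟩
    rw [hasFiniteIntegral_iff_ofReal (Filter.Eventually.of_forall fun ω => (hpos t ω).le), h1]
    exact ENNReal.one_lt_top
  · rw [S.history_eq_comap] at hA
    obtain ⟨B, hB, rfl⟩ := hA
    rw [hset s B hB, hset t B (pathHistory_mono S.i₀ S.c hst B hB)]
  · let G : ℕ → ℝ≥0 → ℝ := fun m v => 1 - poExpSurvival (S.lamStar rStar (pattern S.i₀ m))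
      (S.muStar RStar (pattern S.i₀ m)) v
    have hG : ∀ m, Filter.Tendsto (G m) Filter.atTop (nhds 1) := fun m => by
      have h := ((hproper (pattern S.i₀ m)).comp
        (NNReal.tendsto_coe_atTop.2 Filter.tendsto_id)).const_sub 1
      simpa using! h
    have hinit : ∀ (k : ℕ) (u : ℕ → ℝ≥0),
        Q.real {ω | ∀ m < k, S.T m ω ≤ u m} = ∏ m ∈ Finset.range k, G m (u m) := fun k u => by
      -- The horizon is the sum of the bounds, the least time at which `hjoint` applies.
      obtain ⟨h1, h2⟩ := hjoint k u _ le_rfl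
      rw [hQZ _ _ h1, h2]
    refine ⟨iIndepFun_of_initial S.measurable_T hG hinit, fun m => ⟨S.measurable_T m, fun v => ?_⟩⟩
    have h1 := measureReal_biInter_le_of_initial S.measurable_T hG hinit {m} fun _ => v
    have h2 : {ω | (v : ℝ≥0∞) < S.T m ω} = {ω | ∀ k ∈ ({m} : Finset ℕ), S.T k ω ≤ v}ᶜ := by
      ext ω
      simp
    rw [h2, probReal_compl_eq_one_sub (by
      simpa using measurableSet_le (S.measurable_T m) measurable_const), h1]
    simp [G]
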